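/- Let $S$ be a combinatorial closed disk, i.e. a finite simplicial $2$-complex triangulating a topological closed disk (a finite, connected, simply connected triangulated surface with nonempty boundary), and let $\alpha:V(S)\to\mathbb R$, $\eta:E(S)\to\mathbb R$ be arbitrary. A function $f:V(S)\to\mathbb R$ is a label in $C_{\alpha,\eta}$ if the numbers $$\ell_{vw}^2=\alpha_v e^{2f_v}+\alpha_w e^{2f_w}+2\eta_{vw}e^{f_v+f_w}\qquad(vw\in E(S))$$ are positive and the lengths $\ell_{vw}>0$ satisfy the strict triangle inequalities in every face. It is a flat label if moreover, at every interior vertex $v$ of $S$, the curvature $K_v=2\pi-\sum_{t}\theta(v<t)$ vanishes, where $\theta(v<t)$ is the angle at $v$ of the Euclidean triangle with the side lengths $\ell$ of the face $t\ni v$. On $\mathbb R^4$ let $\xi*\zeta=\xi^1\zeta^1+\xi^2\zeta^2+\xi^3\zeta^3-\xi^4\zeta^4$, let $\mathbb R^4_\perp=\{\xi:\xi^3<\xi^4\}$, and for $\xi\in\mathbb R^4_\perp$ put $$p(\xi)=\Big(\frac{\xi^1}{\xi^4-\xi^3},\frac{\xi^2}{\xi^4-\xi^3}\Big)\in\mathbb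 R^2,\qquad W(\xi)=\frac{\xi*\xi}{(\xi^4-\xi^3)^2}.$$ An M-weighted triangulation $(S,\xi)$ is a map $\xi:V(S)\to\mathbb R^4_\perp$ such that the points $p(\xi_v)$ are the vertices of a realization of $S$ as a (possibly globally self-overlapping) triangulation of a plane region: the piecewise affine map $S\to\mathbb R^2$ with vertex values $p(\xi_v)$ is injective on each simplex, and locally injective at the interior points of $S$, in the sense that for every simplex $\sigma\not\subset\partial S$ the images of any two simplices $s,t\supseteq\sigma$ of $S$ intersect only in the image of $s\cap t$. Two M-weighted triangulations $(S,\xi)$, $(S,\xi')$ are Euclidean equivalent if $\xi'_v=L\xi_v$ for all $v$, where $L$ is an invertible linear map of $\mathbb R^4$ that preserves the product $*$ and the set $\mathbb R^4_\perp$ and for which there is an isometry $g$ of $\mathbb R^2$ (orientation preserving or not) with $p(L\xi)=g(p(\xi))$ and $W(L\xi)=W(\xi)$ for all $\xi\in\mathbb R^4_\perp$. Then there is a one-to-one correspondence between the Euclidean equivalence classes of M-weighted triangulations $(S,\xi)$ with $$\xi_v*\xi_v=\alpha_v\ (v\in V(S)),\qquad \xi_v*\xi_w=-\eta_{vw}\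 (vw\in E(S)),$$ and the flat labels in $C_{\alpha,\eta}$. It sends the class of $(S,\xi)$ to the label $f_v=-\log(\xi_v^4-\xi_v^3)$, which is well defined on classes, and the corresponding lengths are $\ell_{vw}=|p(\xi_v)-p(\xi_w)|$ for all $vw\in E(S)$. -/

import Mathlib

/-! ### Combinatorial closed disks -/

section Complex

variable {V : Type*} [Fintype V] [DecidableEq V]

/-- The 1-skeleton (graph of edges) of a simplicial complex. -/
def skeleton (S : AbstractSimplicialComplex V) : SimpleGraph V where
  Adj v w := v ≠ w ∧ ({v, w} : Finset V) ∈ S.faces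
  symm := ⟨fun v w h => ⟨h.1.symm, by rw [Finset.pair_comm]; exact h.2⟩⟩
  loopless := ⟨fun _ h => h.1 rfl⟩

open Classical in
/-- The set `F(S)` of triangular faces. -/
noncomputable def triangles (S : AbstractSimplicialComplex V) : Finset (Finset V) :=
  Finset.univ.filter fun t => t ∈ S.faces ∧ t.card = 3

/-- The triangular faces that contain the simplex `e`. -/
noncomputable def trianglesThrough (S : AbstractSimplicialComplex V) (e : Finset V) :
    Finset (Finset V) :=
  (triangles S).filter fun t => e ⊆ t

/-- The link of the vertex `v` in a 2-dimensional complex, as a graph on the neighbours of `v`: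
`u` and `w` are joined when `v, u, w` span a triangle. -/
def linkGraph (S : AbstractSimplicialComplex V) (v : V) :
    SimpleGraph {u : V // (skeleton S).Adj v u} where
  Adj u w := u ≠ w ∧ ({v, u.1, w.1} : Finset V) ∈ S.faces
  symm := ⟨fun u w h => ⟨h.1.symm, by rw [Finset.pair_comm]; exact h.2⟩⟩
  loopless := ⟨fun _ h => h.1 rfl⟩

/-- Homotopy (rel endpoints) of edge paths: the equivalence relation generated by cancelling a
backtrack `u, v, u` and replacing `u, v, w` by `u, w` when `u, v, w` span a triangle. Its classes
of closed paths at a vertex form the edge-path group, i.e. the fundamental group. -/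
inductive EdgeHomotopic (S : AbstractSimplicialComplex V) :
    ∀ {u v : V}, (skeleton S).Walk u v → (skeleton S).Walk u v → Prop
  | refl {u v : V} (p : (skeleton S).Walk u v) : EdgeHomotopic S p p
  | symm {u v : V} {p q : (skeleton S).Walk u v} : EdgeHomotopic S p q → EdgeHomotopic S q p
  | trans {u v : V} {p q r : (skeleton S).Walk u v} :
      EdgeHomotopic S p q → EdgeHomotopic S q r → EdgeHomotopic S p r
  | cons {u v w : V} (h : (skeleton S).Adj u v) {p q : (skeleton S).Walk v w} :
      EdgeHomotopic S p q →
        EdgeHomotopic S (SimpleGraph.Walk.cons h p) (SimpleGraph.Walk.cons h q)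
  | backtrack {u v w : V} (h : (skeleton S).Adj u v) (h' : (skeleton S).Adj v u)
      (p : (skeleton S).Walk u w) :
      EdgeHomotopic S (SimpleGraph.Walk.cons h (SimpleGraph.Walk.cons h' p)) p
  | triangle {u v w x : V} (huv : (skeleton S).Adj u v) (hvw : (skeleton S).Adj v w)
      (huw : (skeleton S).Adj u w) (ht : ({u, v, w} : Finset V) ∈ S.faces)
      (p : (skeleton S).Walk w x) :
      EdgeHomotopic S (SimpleGraph.Walk.cons huv (SimpleGraph.Walk.cons hvw p))
        (SimpleGraph.Walk.cons huw p)

/-- A boundary edge: an edge lying in exactly one triangle. -/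
def IsBoundaryEdge (S : AbstractSimplicialComplex V) (e : Finset V) : Prop :=
  e ∈ S.faces ∧ e.card = 2 ∧ (trianglesThrough S e).card = 1

/-- `s` is a simplex of the boundary complex `∂S`. -/
def IsBoundarySimplex (S : AbstractSimplicialComplex V) (s : Finset V) : Prop :=
  s ∈ S.faces ∧ ∃ e, IsBoundaryEdge S e ∧ s ⊆ e

/-- `s` is a simplex of `S` that does not lie in `∂S`. -/
def IsInteriorSimplex (S : AbstractSimplicialComplex V) (s : Finset V) : Prop :=
  s ∈ S.faces ∧ ¬ IsBoundarySimplex S s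

/-- `v` is a vertex of the interior of `S`. -/
def IsInteriorVertex (S : AbstractSimplicialComplex V) (v : V) : Prop :=
  IsInteriorSimplex S {v}

/-- A combinatorial closed disk: a finite triangulated surface with boundary which is (connected
and) simply connected and has nonempty boundary. The first three fields say that `S` is a
triangulated surface with boundary: the link of each vertex is a finite connected graph all of
whose degrees are 1 or 2, that is, a path with at least one edge or a cycle. -/
structure IsCombinatorialClosedDisk (S : AbstractSimplicialComplex V) : Prop where
  card_le : ∀ s ∈ S.faces, s.card ≤ 3
  edge : ∀ e ∈ S.faces, e.card = 2 →
    (trianglesThrough S e).card = 1 ∨ (trianglesThrough S e).card = 2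
  link_connected : ∀ v, (linkGraph S v).Connected
  connected : (skeleton S).Connected
  simply_connected : ∀ (v : V) (p : (skeleton S).Walk v v),
    EdgeHomotopic S p SimpleGraph.Walk.nil
  boundary_nonempty : ∃ e, IsBoundaryEdge S e

/-! ### Labels and curvature -/

/-- `ℓ_{vw}² = α_v e^{2 f_v} + α_w e^{2 f_w} + 2 η_{vw} e^{f_v + f_w}`. Only the values of `η` on
edges of the complex are ever used. -/
noncomputable def edgeLengthSq (α : V → ℝ) (η : Sym2 V → ℝ) (f : V → ℝ) (v w : V) : ℝ :=
  α v * Real.exp (2 * f v) + α w * Real.exp (2 * f w) + 2 * η s(v, w) * Real.exp (f v + f w)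

/-- The length `ℓ_{vw}` of an edge. -/
noncomputable def edgeLength (α : V → ℝ) (η : Sym2 V → ℝ) (f : V → ℝ) (v w : V) : ℝ :=
  Real.sqrt (edgeLengthSq α η f v w)

/-- `f ∈ C_{α,η}`: the label determines a geometry on `S`, i.e. all `ℓ_{vw}²` are positive and the
edges of each face satisfy the strict triangle inequalities. -/
structure IsLabel (S : AbstractSimplicialComplex V) (α : V → ℝ) (η : Sym2 V → ℝ)
    (f : V → ℝ) : Prop where
  pos : ∀ v w, (skeleton S).Adj v w → 0 < edgeLengthSq α η f v w
  triangle : ∀ u v w, ({u, v, w} : Finset V) ∈ triangles S →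
    edgeLength α η f u w < edgeLength α η f u v + edgeLength α η f v w

/-- The angle between sides of lengths `a`, `b` in a Euclidean triangle with third side `c`. -/
noncomputable def angleOfSides (a b c : ℝ) : ℝ :=
  Real.arccos ((a ^ 2 + b ^ 2 - c ^ 2) / (2 * a * b))

/-- The angle `θ(v < t)` at `v` in the triangle `t`, and `0` when `v ∉ t`. For `t = {v, u, w}` the
double sum contains the angle twice, once for each order of `u` and `w`. -/
noncomputable def faceAngle (α : V → ℝ) (η : Sym2 V → ℝ) (f : V → ℝ) (v : V) (t : Finset V) : ℝ :=
  if v ∈ t then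
    (∑ u ∈ t.erase v, ∑ w ∈ (t.erase v).erase u,
      angleOfSides (edgeLength α η f v u) (edgeLength α η f v w) (edgeLength α η f u w)) / 2
  else 0

/-- The curvature `K_v = 2π - ∑_t θ(v < t)`, the sum being over all triangles `t` of `S`. -/
noncomputable def curvature (S : AbstractSimplicialComplex V) (α : V → ℝ) (η : Sym2 V → ℝ)
    (f : V → ℝ) (v : V) : ℝ :=
  2 * Real.pi - ∑ t ∈ triangles S, faceAngle α η f v t

/-- Flat labels in `C_{α,η}`: labels whose curvature vanishes at all interior vertices. -/
def FlatLabel (S : AbstractSimplicialComplex V) (α : V → ℝ) (η : Sym2 V → ℝ) : Type _ :=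
  {f : V → ℝ // IsLabel S α η f ∧ ∀ v, IsInteriorVertex S v → curvature S α η f v = 0}

end Complex

/-! ### M-weighted points -/

/-- The Minkowski product on `ℝ⁴`. -/
def minkowski (ξ ζ : Fin 4 → ℝ) : ℝ :=
  ξ 0 * ζ 0 + ξ 1 * ζ 1 + ξ 2 * ζ 2 - ξ 3 * ζ 3

/-- The set `ℝ⁴_⊥` of M-weighted points. -/
def MWeightedPoints : Set (Fin 4 → ℝ) := {ξ | ξ 2 < ξ 3}

/-- The point `p(ξ)` of the plane given by an M-weighted point `ξ`. -/
noncomputable def planePoint (ξ : Fin 4 → ℝ) : EuclideanSpace ℝ (Fin 2) :=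
  !₂[ξ 0 / (ξ 3 - ξ 2), ξ 1 / (ξ 3 - ξ 2)]

/-- The weight `W(ξ)` of an M-weighted point `ξ`. -/
noncomputable def pointWeight (ξ : Fin 4 → ℝ) : ℝ :=
  minkowski ξ ξ / (ξ 3 - ξ 2) ^ 2

/-- The group of Euclidean transformations of M-weighted points: the invertible linear maps of
`ℝ⁴` that preserve the Minkowski product and `ℝ⁴_⊥`, act on the points `p(ξ)` through an isometry
`g` of the plane (possibly reversing orientation), and preserve the weights `W(ξ)`. -/
def euclideanTransformations : Subgroup ((Fin 4 → ℝ) ≃ₗ[ℝ] (Fin 4 → ℝ)) where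
  carrier := {L |
    (∀ ξ ζ, minkowski (L ξ) (L ζ) = minkowski ξ ζ) ∧
    (∀ ξ, L ξ ∈ MWeightedPoints ↔ ξ ∈ MWeightedPoints) ∧
    ∃ g : EuclideanSpace ℝ (Fin 2) ≃ᵢ EuclideanSpace ℝ (Fin 2), ∀ ξ ∈ MWeightedPoints,
      planePoint (L ξ) = g (planePoint ξ) ∧ pointWeight (L ξ) = pointWeight ξ}
  one_mem' := ⟨fun _ _ => rfl, fun _ => Iff.rfl, IsometryEquiv.refl _, fun _ _ => ⟨rfl, rfl⟩⟩
  mul_mem' := by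
    rintro L M ⟨h1, h2, g, h3⟩ ⟨k1, k2, g', k3⟩
    refine ⟨fun ξ ζ => (h1 _ _).trans (k1 _ _), fun ξ => (h2 _).trans (k2 _), g'.trans g,
      fun ξ hξ => ?_⟩
    obtain ⟨a, b⟩ := h3 (M ξ) ((k2 ξ).2 hξ)
    obtain ⟨c, d⟩ := k3 ξ hξ
    refine ⟨?_, b.trans d⟩
    change planePoint (L (M ξ)) = g (g' (planePoint ξ))
    rw [a, c]
  inv_mem' := by
    rintro L ⟨h1, h2, g, h3⟩
    have hL : ∀ ξ, L (L⁻¹ ξ) = ξ := fun ξ => L.apply_symm_apply ξ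
    have hmem : ∀ ξ, L⁻¹ ξ ∈ MWeightedPoints ↔ ξ ∈ MWeightedPoints := fun ξ => by
      rw [← h2, hL]
    refine ⟨fun ξ ζ => ?_, hmem, g.symm, fun ξ hξ => ?_⟩
    · rw [← h1, hL, hL]
    · obtain ⟨a, b⟩ := h3 (L⁻¹ ξ) ((hmem ξ).2 hξ)
      rw [hL] at a b
      exact ⟨by rw [a, IsometryEquiv.symm_apply_apply], b.symm⟩

/-! ### M-weighted triangulations -/

section Triangulation

variable {V : Type*} [Fintype V] [DecidableEq V]

/-- The image in the plane of the simplex `s`, when each vertex `v` is placed at `p(ξ_v)`. -/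
def simplexImage (ξ : V → Fin 4 → ℝ) (s : Finset V) : Set (EuclideanSpace ℝ (Fin 2)) :=
  convexHull ℝ ((fun v => planePoint (ξ v)) '' (s : Set V))

/-- An M-weighted triangulation `(S, ξ)`: M-weighted points `ξ_v` such that the points `p(ξ_v)` are
the vertices of a realisation of `S` as a triangulation of a plane region, which may overlap itself
globally. That is, simplices are nondegenerate, and any two simplices `s`, `t` around a common
interior simplex `σ` meet exactly in their common face; equivalently, the piecewise affine map
from `S` to the plane with vertex values `p(ξ_v)` is injective on every simplex and locally
injective at every interior point of `S`. -/
structure MWeightedTriangulation (S : AbstractSimplicialComplex V) where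
  ξ : V → Fin 4 → ℝ
  mem : ∀ v, ξ v ∈ MWeightedPoints
  nondegenerate : ∀ s ∈ S.faces, AffineIndependent ℝ fun v : s => planePoint (ξ v)
  inter_subset : ∀ σ, IsInteriorSimplex S σ → ∀ s ∈ S.faces, ∀ t ∈ S.faces, σ ⊆ s → σ ⊆ t →
    simplexImage ξ s ∩ simplexImage ξ t ⊆ simplexImage ξ (s ∩ t)

/-- The prescribed products: `ξ_v * ξ_v = α_v` at vertices and `ξ_v * ξ_w = -η_{vw}` on edges. -/
def HasProducts {S : AbstractSimplicialComplex V} (T : MWeightedTriangulation S)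
    (α : V → ℝ) (η : Sym2 V → ℝ) : Prop :=
  (∀ v, minkowski (T.ξ v) (T.ξ v) = α v) ∧
    ∀ v w, (skeleton S).Adj v w → minkowski (T.ξ v) (T.ξ w) = -η s(v, w)

/-- Equivalence of M-weighted triangulations (with prescribed products) up to Euclidean
transformations. -/
def euclideanSetoid (S : AbstractSimplicialComplex V) (α : V → ℝ) (η : Sym2 V → ℝ) :
    Setoid {T : MWeightedTriangulation S // HasProducts T α η} where
  r T T' := ∃ L ∈ euclideanTransformations, ∀ v, T'.1.ξ v = L (T.1.ξ v)
  iseqv :=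
    { refl := fun _ => ⟨1, one_mem _, fun _ => rfl⟩
      symm := by
        rintro T T' ⟨L, hL, h⟩
        refine ⟨L⁻¹, inv_mem hL, fun v => ?_⟩
        rw [h]
        exact (L.symm_apply_apply _).symm
      trans := by
        rintro T T' T'' ⟨L, hL, h⟩ ⟨M, hM, k⟩
        exact ⟨M * L, mul_mem hM hL, fun v => by rw [k, h]; rfl⟩ }

end Triangulation

/-! An M-weighted point is determined by its height `ξ 3 - ξ 2`, its position `planePoint ξ` and its
square (`MWeightedPoints.ext`). Dividing two points by their heights turns their Minkowski products
into the squared distance of their positions (`dist_planePoint_sq`). With `f` equal to minus the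
logarithm of the height and the squares fixed to `α`, prescribing the product on an edge is
therefore the same as prescribing the distance of its endpoints to be `edgeLength α η f`. Euclidean
transformations preserve heights (`height_map_of_mem`) and induce every isometry on positions
(`exists_euclideanTransformation`). What remains is plane geometry: for lengths that satisfy the
strict triangle inequalities, realizations of `S` without local overlap exist exactly when the
curvature vanishes at interior vertices, and they are unique up to isometry.

The intermediate notion is a development: the triangles have the prescribed side lengths, and two
triangles with a common edge lie on opposite sides of it. A third vertex is then determined by its
neighbour across the edge, so an isometry that matches one triangle matches the next, and
connectedness of links and of `S` gives uniqueness (`development_unique`). For existence, each star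
is laid out in polar coordinates, where an interior star closes up because its angle sum is `2π`
(`exists_starDevelopment`). The isometries that compare neighbouring stars form a cocycle on
triangles, which is trivial since `S` is simply connected (`exists_potential`), and so the stars
glue (`exists_development`).

Local injectivity corresponds to angle sum `2π`. Around an interior vertex a developed star turns in
one sense and closes up, so its angle sum is a positive multiple of `2π`. A second turn would cover
an edge by a later triangle (`winding_eq_one`), while after a single turn the sectors meet only
along common sides (`sector_inter`). -/

set_option linter.unusedSectionVars false

/-! ### Plane geometry -/

/-- The Euclidean plane. -/
abbrev Plane := EuclideanSpace ℝ (Fin 2)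

/-- Twice the signed area of the triangle `x y z`. -/
def crossAt (x y z : Plane) : ℝ := (y 0 - x 0) * (z 1 - x 1) - (y 1 - x 1) * (z 0 - x 0)

/-- The inner product of `y - x` and `z - x`. -/
def dotAt (x y z : Plane) : ℝ := (y 0 - x 0) * (z 0 - x 0) + (y 1 - x 1) * (z 1 - x 1)

theorem Plane.ext {x y : Plane} (h0 : x 0 = y 0) (h1 : x 1 = y 1) : x = y := by
  ext i; fin_cases i <;> assumption

theorem Plane.dist_sq (x y : Plane) : dist x y ^ 2 = (x 0 - y 0) ^ 2 + (x 1 - y 1) ^ 2 := by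
  rw [EuclideanSpace.dist_eq, Fin.sum_univ_two, Real.sq_sqrt (by positivity), Real.dist_eq,
    Real.dist_eq, sq_abs, sq_abs]

theorem Plane.dist_eq_iff {x y : Plane} {d : ℝ} (hd : 0 ≤ d) :
    dist x y = d ↔ (x 0 - y 0) ^ 2 + (x 1 - y 1) ^ 2 = d ^ 2 := by
  rw [← Plane.dist_sq]
  exact (sq_eq_sq₀ dist_nonneg hd).symm

theorem dotAt_eq_dist (x y z : Plane) :
    dotAt x y z = (dist x y ^ 2 + dist x z ^ 2 - dist y z ^ 2) / 2 := by
  simp only [Plane.dist_sq, dotAt]; ring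

/-- Products of two signed areas over the same base are polynomials in distances. They are thus
invariant under all isometries, including reflections, and this allows "same side" and "opposite
sides" to be handled without choosing an orientation. -/
theorem crossAt_mul_crossAt (x y z w : Plane) :
    crossAt x y z * crossAt x y w
      = dist x y ^ 2 * dotAt x z w - dotAt x y z * dotAt x y w := by
  simp only [Plane.dist_sq, dotAt, crossAt]; ring

theorem crossAt_swap_right (x y z : Plane) : crossAt x z y = -crossAt x y z := by
  unfold crossAt; ring

theorem crossAt_swap_left (x y z : Plane) : crossAt y x z = -crossAt x y z := by
  unfold crossAt; ring

/-- The dot and cross products are the real and imaginary parts of the product of `c + di` with the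
conjugate of `a + bi`, and a nonzero complex factor cancels. -/
theorem eq_of_dot_cross {a b c d e f : ℝ} (h : a ^ 2 + b ^ 2 ≠ 0)
    (hd : a * c + b * d = a * e + b * f) (hc : a * d - b * c = a * f - b * e) :
    c = e ∧ d = f := by
  constructor
  · apply mul_left_cancel₀ h; linear_combination a * hd - b * hc
  · apply mul_left_cancel₀ h; linear_combination b * hd + a * hc

theorem Plane.eq_of_dotAt_crossAt {x y z w : Plane} (h : x ≠ y)
    (hd : dotAt x y z = dotAt x y w) (hc : crossAt x y z = crossAt x y w) : z = w := by
  have h0 : (y 0 - x 0) ^ 2 + (y 1 - x 1) ^ 2 ≠ 0 := by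
    rw [← Plane.dist_sq]; exact pow_ne_zero 2 (dist_ne_zero.2 h.symm)
  obtain ⟨h1, h2⟩ := eq_of_dot_cross h0 hd hc
  exact Plane.ext (by linarith) (by linarith)

theorem ne_of_crossAt_ne_zero {x y z : Plane} (h : crossAt x y z ≠ 0) : x ≠ y := by
  rintro rfl; exact h (by simp [crossAt])

theorem crossAt_ne_zero_of_strict_triangle {x y z : Plane} (h1 : dist x y < dist x z + dist z y)
    (h2 : dist x z < dist x y + dist y z) (h3 : dist y z < dist y x + dist x z) :
    crossAt x y z ≠ 0 := by
  intro h
  have e := crossAt_mul_crossAt x y z z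
  rw [h, dotAt_eq_dist, dotAt_eq_dist, dist_self] at e
  rw [dist_comm z y] at h1
  rw [dist_comm y x] at h3
  -- Heron's formula: this product is four times the square of `crossAt x y z`.
  have hpos : 0 < (dist x y + dist x z + dist y z) * (dist x z + dist y z - dist x y) *
      (dist x y + dist y z - dist x z) * (dist x y + dist x z - dist y z) := by
    have : 0 < dist x y + dist x z + dist y z := by
      linarith [dist_nonneg (x := x) (y := y), dist_nonneg (x := x) (y := z)]
    have := sub_pos.2 h1; have := sub_pos.2 h2; have := sub_pos.2 h3
    positivity
  nlinarith [hpos, e]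

/-- A point of the plane is determined by its distances to three points that are not collinear. -/
theorem Plane.eq_of_dist_eq {x y z a b : Plane} (h : crossAt x y z ≠ 0)
    (hx : dist x a = dist x b) (hy : dist y a = dist y b) (hz : dist z a = dist z b) : a = b := by
  have e1 : dotAt x y a = dotAt x y b := by rw [dotAt_eq_dist, dotAt_eq_dist, hx, hy]
  have e2 : dotAt x z a = dotAt x z b := by rw [dotAt_eq_dist, dotAt_eq_dist, hx, hz]
  refine Plane.eq_of_dotAt_crossAt (ne_of_crossAt_ne_zero h) e1 ?_
  have e := crossAt_mul_crossAt x y z a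
  have e' := crossAt_mul_crossAt x y z b
  apply mul_left_cancel₀ h
  rw [e, e', e1, e2]

theorem isometryEquiv_eq_of_three {g g' : Plane ≃ᵢ Plane} {x y z : Plane} (h : crossAt x y z ≠ 0)
    (hx : g x = g' x) (hy : g y = g' y) (hz : g z = g' z) : g = g' := by
  have key : g'.symm.trans g = IsometryEquiv.refl _ := by
    apply IsometryEquiv.ext
    intro w
    change g (g'.symm w) = w
    obtain ⟨w, rfl⟩ := g'.surjective w
    -- The goal becomes that `g'⁻¹ ∘ g` fixes `w`. This map fixes `x`, `y`, `z`, so `w` and its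
    -- image have the same distances to three points that are not collinear.
    rw [IsometryEquiv.symm_apply_apply, ← g'.symm.injective.eq_iff]
    rw [IsometryEquiv.symm_apply_apply]
    refine Plane.eq_of_dist_eq h ?_ ?_ ?_
    · rw [← g'.dist_eq, IsometryEquiv.apply_symm_apply, ← hx, g.dist_eq]
    · rw [← g'.dist_eq, IsometryEquiv.apply_symm_apply, ← hy, g.dist_eq]
    · rw [← g'.dist_eq, IsometryEquiv.apply_symm_apply, ← hz, g.dist_eq]
  ext1 w
  have := congrArg (fun k : Plane ≃ᵢ Plane => k (g' w)) key
  change g (g'.symm (g' w)) = g' w at this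
  rwa [IsometryEquiv.symm_apply_apply] at this

/-- The isometry with linear part the product of a rotation and a reflection (when `ε = -1`) and
translation part `b`. -/
noncomputable def planarIsometry (c s ε : ℝ) (b : Plane) (h : c ^ 2 + s ^ 2 = 1)
    (hε : ε ^ 2 = 1) : Plane ≃ᵢ Plane :=
  IsometryEquiv.mk' (fun z => !₂[c * z 0 - ε * s * z 1 + b 0, s * z 0 + ε * c * z 1 + b 1])
    (fun w => !₂[c * (w 0 - b 0) + s * (w 1 - b 1), ε * (-s * (w 0 - b 0) + c * (w 1 - b 1))])
    (by
      intro w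
      apply Plane.ext
      · change c * (c * (w 0 - b 0) + s * (w 1 - b 1))
          - ε * s * (ε * (-s * (w 0 - b 0) + c * (w 1 - b 1))) + b 0 = w 0
        linear_combination (w 0 - b 0) * h + (s ^ 2 * (w 0 - b 0) - s * c * (w 1 - b 1)) * hε
      · change s * (c * (w 0 - b 0) + s * (w 1 - b 1))
          + ε * c * (ε * (-s * (w 0 - b 0) + c * (w 1 - b 1))) + b 1 = w 1
        linear_combination (w 1 - b 1) * h + (c ^ 2 * (w 1 - b 1) - s * c * (w 0 - b 0)) * hε)
    (by
      refine Isometry.of_dist_eq fun x y => ?_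
      rw [Plane.dist_eq_iff dist_nonneg, Plane.dist_sq]
      change ((c * x 0 - ε * s * x 1 + b 0) - (c * y 0 - ε * s * y 1 + b 0)) ^ 2
        + ((s * x 0 + ε * c * x 1 + b 1) - (s * y 0 + ε * c * y 1 + b 1)) ^ 2 = _
      linear_combination ((x 0 - y 0) ^ 2 + ε ^ 2 * (x 1 - y 1) ^ 2) * h + (x 1 - y 1) ^ 2 * hε)

theorem planarIsometry_apply (c s ε : ℝ) (b : Plane) (h : c ^ 2 + s ^ 2 = 1) (hε : ε ^ 2 = 1)
    (z : Plane) : planarIsometry c s ε b h hε z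
      = !₂[c * z 0 - ε * s * z 1 + b 0, s * z 0 + ε * c * z 1 + b 1] := rfl

/-- Congruent triangles are related by an isometry of the plane. -/
theorem exists_planarIsometry {x y z x' y' z' : Plane} (h : crossAt x y z ≠ 0)
    (hxy : dist x y = dist x' y') (hxz : dist x z = dist x' z') (hyz : dist y z = dist y' z') :
    ∃ (c s ε : ℝ) (b : Plane) (hcs : c ^ 2 + s ^ 2 = 1) (hε : ε ^ 2 = 1),
      planarIsometry c s ε b hcs hε x = x' ∧ planarIsometry c s ε b hcs hε y = y' ∧
      planarIsometry c s ε b hcs hε z = z' := by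
  have hd : dotAt x y z = dotAt x' y' z' := by
    rw [dotAt_eq_dist, dotAt_eq_dist, hxy, hxz, hyz]
  have hcc : crossAt x' y' z' * crossAt x' y' z' = crossAt x y z * crossAt x y z := by
    simp only [crossAt_mul_crossAt, dotAt_eq_dist, hxy, hxz, hyz, dist_self]
  have hne := ne_of_crossAt_ne_zero h
  have hn : (y 0 - x 0) ^ 2 + (y 1 - x 1) ^ 2 ≠ 0 := by
    rw [← Plane.dist_sq]; exact pow_ne_zero 2 (dist_ne_zero.2 hne.symm)
  have hnn : (y' 0 - x' 0) ^ 2 + (y' 1 - x' 1) ^ 2 = (y 0 - x 0) ^ 2 + (y 1 - x 1) ^ 2 := by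
    rw [← Plane.dist_sq, ← Plane.dist_sq, dist_comm, ← hxy, dist_comm]
  set N := (y 0 - x 0) ^ 2 + (y 1 - x 1) ^ 2 with hN
  -- The ratio of the signed areas is a sign, because congruent triangles have equal squared areas.
  obtain ⟨ε, hεd⟩ : ∃ ε, ε * crossAt x y z = crossAt x' y' z' := ⟨_, div_mul_cancel₀ _ h⟩
  have hε : ε ^ 2 = 1 := by
    apply mul_right_cancel₀ (mul_ne_zero h h)
    linear_combination (ε * crossAt x y z + crossAt x' y' z') * hεd + hcc
  -- As complex numbers, `c + si` is the quotient of `y' - x'` by `y - x`, where the latter has been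
  -- conjugated if `ε = -1`.
  obtain ⟨c, hc⟩ : ∃ c, c * N = (y 0 - x 0) * (y' 0 - x' 0) + ε * (y 1 - x 1) * (y' 1 - x' 1) :=
    ⟨_, div_mul_cancel₀ _ hn⟩
  obtain ⟨s, hs⟩ : ∃ s, s * N = (y 0 - x 0) * (y' 1 - x' 1) - ε * (y 1 - x 1) * (y' 0 - x' 0) :=
    ⟨_, div_mul_cancel₀ _ hn⟩
  have hcs : c ^ 2 + s ^ 2 = 1 := by
    apply mul_right_cancel₀ (mul_ne_zero hn hn)
    have : (c ^ 2 + s ^ 2) * (N * N) = (c * N) ^ 2 + (s * N) ^ 2 := by ring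
    rw [this, hc, hs]
    have h2 : (y 0 - x 0) ^ 2 + ε ^ 2 * (y 1 - x 1) ^ 2 = N := by rw [hε, one_mul]
    calc _ = ((y 0 - x 0) ^ 2 + ε ^ 2 * (y 1 - x 1) ^ 2)
          * ((y' 0 - x' 0) ^ 2 + (y' 1 - x' 1) ^ 2) := by ring
      _ = _ := by rw [h2, hnn]; ring
  have hy0 : c * (y 0 - x 0) - ε * s * (y 1 - x 1) = y' 0 - x' 0 := by
    apply mul_right_cancel₀ hn
    linear_combination (y 0 - x 0) * hc - ε * (y 1 - x 1) * hs
      + (y 1 - x 1) ^ 2 * (y' 0 - x' 0) * hε - (y' 0 - x' 0) * hN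
  have hy1 : s * (y 0 - x 0) + ε * c * (y 1 - x 1) = y' 1 - x' 1 := by
    apply mul_right_cancel₀ hn
    linear_combination (y 0 - x 0) * hs + ε * (y 1 - x 1) * hc
      + (y 1 - x 1) ^ 2 * (y' 1 - x' 1) * hε - (y' 1 - x' 1) * hN
  refine ⟨c, s, ε, !₂[x' 0 - (c * x 0 - ε * s * x 1), x' 1 - (s * x 0 + ε * c * x 1)], hcs, hε,
    ?_, ?_, ?_⟩
  · apply Plane.ext
    · change c * x 0 - ε * s * x 1 + (x' 0 - (c * x 0 - ε * s * x 1)) = x' 0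
      ring
    · change s * x 0 + ε * c * x 1 + (x' 1 - (s * x 0 + ε * c * x 1)) = x' 1
      ring
  · apply Plane.ext
    · change c * y 0 - ε * s * y 1 + (x' 0 - (c * x 0 - ε * s * x 1)) = y' 0
      linear_combination hy0
    · change s * y 0 + ε * c * y 1 + (x' 1 - (s * x 0 + ε * c * x 1)) = y' 1
      linear_combination hy1
  · have hne' : x' ≠ y' := by rw [← dist_ne_zero, ← hxy, dist_ne_zero]; exact hne
    apply Plane.eq_of_dotAt_crossAt hne'
    · rw [← hd]
      change (y' 0 - x' 0) * (c * z 0 - ε * s * z 1 + (x' 0 - (c * x 0 - ε * s * x 1)) - x' 0)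
        + (y' 1 - x' 1) * (s * z 0 + ε * c * z 1 + (x' 1 - (s * x 0 + ε * c * x 1)) - x' 1)
        = (y 0 - x 0) * (z 0 - x 0) + (y 1 - x 1) * (z 1 - x 1)
      rw [← hy0, ← hy1]
      linear_combination ((y 0 - x 0) * (z 0 - x 0) + ε ^ 2 * (y 1 - x 1) * (z 1 - x 1)) * hcs
        + (y 1 - x 1) * (z 1 - x 1) * hε
    · rw [← hεd]
      change (y' 0 - x' 0) * (s * z 0 + ε * c * z 1 + (x' 1 - (s * x 0 + ε * c * x 1)) - x' 1)
        - (y' 1 - x' 1) * (c * z 0 - ε * s * z 1 + (x' 0 - (c * x 0 - ε * s * x 1)) - x' 0)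
        = ε * ((y 0 - x 0) * (z 1 - x 1) - (y 1 - x 1) * (z 0 - x 0))
      rw [← hy0, ← hy1]
      linear_combination ε * ((y 0 - x 0) * (z 1 - x 1) - (y 1 - x 1) * (z 0 - x 0)) * hcs

/-- Every isometry of the plane is a `planarIsometry`. -/
theorem exists_eq_planarIsometry (g : Plane ≃ᵢ Plane) :
    ∃ (c s ε : ℝ) (b : Plane) (hcs : c ^ 2 + s ^ 2 = 1) (hε : ε ^ 2 = 1),
      g = planarIsometry c s ε b hcs hε := by
  have h : crossAt !₂[0, 0] !₂[1, 0] !₂[0, 1] ≠ 0 := by simp [crossAt]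
  obtain ⟨c, s, ε, b, hcs, hε, h1, h2, h3⟩ := exists_planarIsometry h (g.dist_eq _ _).symm
    (g.dist_eq _ _).symm (g.dist_eq _ _).symm
  exact ⟨c, s, ε, b, hcs, hε, isometryEquiv_eq_of_three h h1.symm h2.symm h3.symm⟩

/-- The third vertex of a triangle is determined by its distances to the other two and the side on
which it lies, compatibly with an isometry. -/
theorem IsometryEquiv.map_eq_of_opposite (g : Plane ≃ᵢ Plane) {x y b c x' y' b' c' : Plane}
    (hx : g x = x') (hy : g y = y') (hb : g b = b')
    (hxc : dist x c = dist x' c') (hyc : dist y c = dist y' c')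
    (h : crossAt x y b * crossAt x y c < 0) (h' : crossAt x' y' b' * crossAt x' y' c' < 0) :
    g c = c' := by
  subst hx hy hb
  have hne : g x ≠ g y :=
    g.injective.ne (ne_of_crossAt_ne_zero (left_ne_zero_of_mul h.ne))
  have hd : dotAt (g x) (g y) (g c) = dotAt (g x) (g y) c' := by
    rw [dotAt_eq_dist, dotAt_eq_dist, ← hxc, ← hyc, g.dist_eq, g.dist_eq, g.dist_eq]
  apply Plane.eq_of_dotAt_crossAt hne hd
  have hsq : crossAt (g x) (g y) (g c) * crossAt (g x) (g y) (g c)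
      = crossAt (g x) (g y) c' * crossAt (g x) (g y) c' := by
    simp only [crossAt_mul_crossAt, dotAt_eq_dist, ← hxc, ← hyc, g.dist_eq, dist_self]
  have hg : crossAt (g x) (g y) (g b) * crossAt (g x) (g y) (g c)
      = crossAt x y b * crossAt x y c := by
    simp only [crossAt_mul_crossAt, dotAt_eq_dist, g.dist_eq]
  rw [← hg] at h
  -- Up to reflection in the base line, `g c` is `c'`; both lie opposite to the image of `b`, which
  -- excludes the reflected position.
  rcases mul_self_eq_mul_self_iff.1 hsq with e | e
  · exact e
  · rw [e] at h; nlinarith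

/-! ### Polar coordinates and sectors -/

section Polar

open Real

/-- The dot product determines the cross product up to sign, the sign is given, and the two products
together determine the second vector. -/
theorem polar_turn {A θ r s x0 x1 y0 y1 : ℝ} (hr : 0 < r) (hs : 0 < s) (hθ : 0 < θ) (hθ' : θ < π)
    (hx0 : x0 = r * cos A) (hx1 : x1 = r * sin A) (hy : y0 ^ 2 + y1 ^ 2 = s ^ 2)
    (hd : x0 * y0 + x1 * y1 = r * s * cos θ) (hc : 0 < x0 * y1 - x1 * y0) :
    y0 = s * cos (A + θ) ∧ y1 = s * sin (A + θ) := by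
  have hsin := sin_pos_of_pos_of_lt_pi hθ hθ'
  have hA := sin_sq_add_cos_sq A
  have hx : x0 ^ 2 + x1 ^ 2 = r ^ 2 := by
    rw [hx0, hx1]; linear_combination r ^ 2 * hA
  have hcr : x0 * y1 - x1 * y0 = r * s * sin θ := by
    rw [← sq_eq_sq₀ hc.le (by positivity)]
    have e := sin_sq_add_cos_sq θ
    linear_combination y0 ^ 2 * hx + y1 ^ 2 * hx + r ^ 2 * hy
      - (x0 * y0 + x1 * y1 + r * s * cos θ) * hd - r ^ 2 * s ^ 2 * e
  refine eq_of_dot_cross (a := x0) (b := x1) (by rw [hx]; positivity) ?_ ?_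
  · rw [hd, hx0, hx1, cos_add, sin_add]; linear_combination -r * s * cos θ * hA
  · rw [hcr, hx0, hx1, cos_add, sin_add]; linear_combination -r * s * sin θ * hA

/-- A nonzero point of a convex sector has polar coordinates with angle in the sector. -/
theorem exists_polar_of_sector {A B r s a b : ℝ} (hr : 0 < r) (hs : 0 < s) (ha : 0 ≤ a)
    (hb : 0 ≤ b) (hab : ¬(a = 0 ∧ b = 0)) (hAB : A < B) (hBA : B < A + π) :
    ∃ ρ φ, 0 < ρ ∧ A ≤ φ ∧ φ ≤ B ∧ (φ = A → b = 0) ∧ (φ = B → a = 0) ∧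
      a * (r * cos A) + b * (s * cos B) = ρ * cos φ ∧
      a * (r * sin A) + b * (s * sin B) = ρ * sin φ := by
  obtain ⟨δ, rfl⟩ : ∃ δ, B = A + δ := ⟨B - A, by ring⟩
  have hδ : 0 < δ := by linarith
  have hδ' : δ < π := by linarith
  have hsin := sin_pos_of_pos_of_lt_pi hδ hδ'
  -- The point rotated by `-A`, so that the sector starts at the positive real axis and `Z.arg` is
  -- the angle measured from its first side.
  set Z : ℂ := ⟨a * r + b * s * cos δ, b * s * sin δ⟩ with hZ
  have hre : ‖Z‖ * cos Z.arg = a * r + b * s * cos δ := Complex.norm_mul_cos_arg Z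
  have him : ‖Z‖ * sin Z.arg = b * s * sin δ := Complex.norm_mul_sin_arg Z
  have hZ0 : Z ≠ 0 := by
    intro h
    have h1 : b * s * sin δ = 0 := congrArg Complex.im h
    have h2 : a * r + b * s * cos δ = 0 := congrArg Complex.re h
    have hb0 : b = 0 := by
      rcases mul_eq_zero.1 h1 with h1 | h1
      · exact (mul_eq_zero.1 h1).resolve_right hs.ne'
      · exact absurd h1 hsin.ne'
    rw [hb0] at h2
    refine hab ⟨?_, hb0⟩
    have : a * r = 0 := by linarith
    exact (mul_eq_zero.1 this).resolve_right hr.ne'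
  have hn : 0 < ‖Z‖ := norm_pos_iff.2 hZ0
  have harg0 : 0 ≤ Z.arg := Complex.arg_nonneg_iff.2 (by change 0 ≤ b * s * sin δ; positivity)
  have hsub : ‖Z‖ * sin (Z.arg - δ) = -(a * r * sin δ) := by
    rw [sin_sub]; linear_combination cos δ * him - sin δ * hre
  have hargδ : Z.arg ≤ δ := by
    by_contra! hlt
    have : 0 < sin (Z.arg - δ) :=
      sin_pos_of_pos_of_lt_pi (by linarith) (by linarith [Complex.arg_le_pi Z])
    have h1 : 0 < ‖Z‖ * sin (Z.arg - δ) := by positivity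
    have h2 : 0 ≤ a * r * sin δ := by positivity
    linarith
  refine ⟨‖Z‖, A + Z.arg, hn, by linarith, by linarith, fun h => ?_, fun h => ?_, ?_, ?_⟩
  · have h0 : Z.arg = 0 := by linarith
    rw [h0, sin_zero, mul_zero] at him
    rcases mul_eq_zero.1 him.symm with h1 | h1
    · exact (mul_eq_zero.1 h1).resolve_right hs.ne'
    · exact absurd h1 hsin.ne'
  · have h0 : Z.arg = δ := by linarith
    rw [h0, sub_self, sin_zero, mul_zero] at hsub
    rcases mul_eq_zero.1 (neg_eq_zero.1 hsub.symm) with h1 | h1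
    · exact (mul_eq_zero.1 h1).resolve_right hr.ne'
    · exact absurd h1 hsin.ne'
  · rw [cos_add, cos_add]; linear_combination -cos A * hre + sin A * him
  · rw [sin_add, sin_add]; linear_combination -sin A * hre - cos A * him

theorem exists_int_of_cos_eq_of_sin_eq {x y : ℝ} (hc : cos x = cos y) (hs : sin x = sin y) :
    ∃ k : ℤ, x - y = 2 * π * k :=
  Real.Angle.angle_eq_iff_two_pi_dvd_sub.1 (Real.Angle.cos_sin_inj hc hs)

/-- Two convex sectors that do not overlap meet at most in a common side. -/
theorem sector_inter {A B C D r s t w a b c d : ℝ} (hr : 0 < r) (hs : 0 < s) (ht : 0 < t)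
    (hw : 0 < w) (ha : 0 ≤ a) (hb : 0 ≤ b) (hc : 0 ≤ c) (hd : 0 ≤ d)
    (hAB : A < B) (hBA : B < A + π) (hBC : B ≤ C) (hCD : C < D) (hDC : D < C + π)
    (hDA : D ≤ A + 2 * π)
    (h0 : a * (r * cos A) + b * (s * cos B) = c * (t * cos C) + d * (w * cos D))
    (h1 : a * (r * sin A) + b * (s * sin B) = c * (t * sin C) + d * (w * sin D)) :
    (a = 0 ∧ b = 0) ∨ (B = C ∧ a = 0) ∨ (D = A + 2 * π ∧ b = 0) := by
  by_cases hab : a = 0 ∧ b = 0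
  · exact Or.inl hab
  obtain ⟨ρ, φ, hρ, hφA, hφB, hA, hB, e0, e1⟩ := exists_polar_of_sector hr hs ha hb hab hAB hBA
  have hcd : ¬(c = 0 ∧ d = 0) := by
    rintro ⟨rfl, rfl⟩
    have z0 : ρ * cos φ = 0 := by rw [← e0, h0]; ring
    have z1 : ρ * sin φ = 0 := by rw [← e1, h1]; ring
    have := sin_sq_add_cos_sq φ
    have : ρ ^ 2 = 0 := by
      linear_combination (-ρ ^ 2) * this + ρ * cos φ * z0 + ρ * sin φ * z1
    exact hρ.ne' (pow_eq_zero_iff two_ne_zero |>.1 this)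
  obtain ⟨σ, ψ, hσ, hψC, hψD, hC, hD, e2, e3⟩ := exists_polar_of_sector ht hw hc hd hcd hCD hDC
  have f0 : ρ * cos φ = σ * cos ψ := by rw [← e0, h0, e2]
  have f1 : ρ * sin φ = σ * sin ψ := by rw [← e1, h1, e3]
  have hρσ : ρ = σ := by
    rw [← sq_eq_sq₀ hρ.le hσ.le]
    have g1 := sin_sq_add_cos_sq φ
    have g2 := sin_sq_add_cos_sq ψ
    linear_combination (-ρ ^ 2) * g1 + σ ^ 2 * g2 + (ρ * cos φ + σ * cos ψ) * f0
      + (ρ * sin φ + σ * sin ψ) * f1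
  subst hρσ
  -- From `A ≤ φ ≤ B ≤ C ≤ ψ ≤ D ≤ A + 2π` the difference `ψ - φ` lies in `[0, 2π]`. As a multiple
  -- of `2π` it is an endpoint of this interval, which forces equality all along the chain on the
  -- corresponding side.
  obtain ⟨k, hk⟩ := exists_int_of_cos_eq_of_sin_eq (mul_left_cancel₀ hρ.ne' f0.symm)
    (mul_left_cancel₀ hρ.ne' f1.symm)
  have hpi := pi_pos
  have hk0 : (-1 : ℝ) < k := by
    by_contra! h
    nlinarith
  have hk1 : (k : ℝ) < 2 := by
    by_contra! h
    nlinarith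
  have hk0' : -1 < k := by exact_mod_cast hk0
  have hk1' : k < 2 := by exact_mod_cast hk1
  have : k = 0 ∨ k = 1 := by omega
  right
  rcases this with rfl | rfl
  · left
    have : ψ = φ := by simpa [sub_eq_zero] using hk
    exact ⟨by linarith, hB (by linarith)⟩
  · right
    have : ψ = φ + 2 * π := by push_cast at hk; linarith
    exact ⟨by linarith, hA (by linarith)⟩

/-- A closed cycle of convex sectors that never covers its initial direction again in between winds
around the origin exactly once. -/
theorem winding_eq_one {a : ℕ → ℝ} {n : ℕ} (hn : 0 < n)
    (ha : ∀ i < n, a i < a (i + 1) ∧ a (i + 1) < a i + π)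
    (hc : cos (a n) = cos (a 0)) (hs : sin (a n) = sin (a 0))
    (hav : ∀ j, 0 < j → j + 1 < n → ∀ c d : ℝ, 0 ≤ c → 0 ≤ d →
      cos (a 0) = c * cos (a j) + d * cos (a (j + 1)) →
      sin (a 0) = c * sin (a j) + d * sin (a (j + 1)) → False) :
    a n = a 0 + 2 * π := by
  have hpi := pi_pos
  have hmono : ∀ i, 0 < i → i ≤ n → a 0 < a i := by
    intro i hi
    induction i with
    | zero => exact absurd hi (lt_irrefl _)
    | succ i ih =>
      intro hin
      rcases Nat.eq_zero_or_pos i with rfl | h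
      · exact (ha 0 hn).1
      · exact (ih h (by omega)).trans (ha i (by omega)).1
  obtain ⟨k, hk⟩ := exists_int_of_cos_eq_of_sin_eq hc hs
  have hk0 : 0 < k := by
    have := hmono n hn le_rfl
    have : (0 : ℝ) < k := by
      by_contra! h
      nlinarith
    exact_mod_cast this
  by_contra hne
  have hk2 : 2 ≤ k := by
    have : k ≠ 1 := by
      rintro rfl
      apply hne
      push_cast at hk; linarith
    omega
  have hk2' : (2 : ℝ) ≤ k := by exact_mod_cast hk2
  have hbig : a 0 + 4 * π ≤ a n := by nlinarith
  -- The first index beyond one full turn ends a sector that contains the initial direction again.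
  -- Since steps are shorter than `π` and `a n` is at least two turns away, this sector is neither
  -- the first nor the last.
  have hex : ∃ m, a 0 + 2 * π < a m := ⟨n, by linarith⟩
  classical
  have hspec := Nat.find_spec hex
  have hmn : Nat.find hex ≤ n := Nat.find_min' hex (by linarith)
  have hm0 : Nat.find hex ≠ 0 := by
    intro h; rw [h] at hspec; linarith
  obtain ⟨j, hj⟩ := Nat.exists_eq_succ_of_ne_zero hm0
  have hjle : a j ≤ a 0 + 2 * π := by
    by_contra! h
    exact Nat.find_min hex (by omega) h
  rw [hj] at hspec hmn
  have hjn : j < n := by omega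
  obtain ⟨h1, h2⟩ := ha j hjn
  have hj0 : 0 < j := by
    rcases Nat.eq_zero_or_pos j with rfl | h
    · exfalso; simp only [Nat.succ_eq_add_one] at hspec; linarith
    · exact h
  have hj1 : j + 1 < n := by
    rcases (show j + 1 ≤ n from hjn).lt_or_eq with h | h
    · exact h
    · exfalso; rw [h] at h2; linarith
  have hpos : 0 < sin (a (j + 1) - a j) := sin_pos_of_pos_of_lt_pi (by linarith) (by linarith)
  have e0 : cos (a 0) = cos (a 0 + 2 * π) := (cos_add_two_pi _).symm
  have e1 : sin (a 0) = sin (a 0 + 2 * π) := (sin_add_two_pi _).symm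
  set φ := a 0 + 2 * π
  -- Cramer's rule for the unit vector of angle `φ` in terms of those of angles `a j` and `a (j +
  -- 1)`.
  refine hav j hj0 hj1 (sin (a (j + 1) - φ) / sin (a (j + 1) - a j))
    (sin (φ - a j) / sin (a (j + 1) - a j)) ?_ ?_ ?_ ?_
  · refine div_nonneg (sin_nonneg_of_nonneg_of_le_pi ?_ ?_) hpos.le <;> linarith
  · refine div_nonneg (sin_nonneg_of_nonneg_of_le_pi ?_ ?_) hpos.le <;> linarith
  · rw [e0]
    field_simp
    simp only [sin_sub]; ring
  · rw [e1]
    field_simp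
    simp only [sin_sub]; ring

end Polar

/-! ### Connected graphs of degree at most two -/

/-- The vertices of a finite connected graph with at most two neighbours at each vertex can be
listed so that consecutive ones are adjacent. -/
theorem SimpleGraph.Connected.exists_hamiltonian_list {W : Type*} [Finite W] {G : SimpleGraph W}
    (hG : G.Connected)
    (hdeg : ∀ u a b c, G.Adj u a → G.Adj u b → G.Adj u c → a = b ∨ a = c ∨ b = c) :
    ∃ (m : ℕ) (u : ℕ → W), (∀ i ≤ m, ∀ j ≤ m, u i = u j → i = j) ∧
      (∀ i < m, G.Adj (u i) (u (i + 1))) ∧ ∀ w, ∃ i ≤ m, u i = w := by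
  classical
  -- A longest simple path is taken; finiteness of `W` bounds the length.
  let P : ℕ → Prop := fun m => ∃ u : ℕ → W, (∀ i ≤ m, ∀ j ≤ m, u i = u j → i = j) ∧
      (∀ i < m, G.Adj (u i) (u (i + 1)))
  have hbound : ∀ m, P m → m ≤ Nat.card W := by
    rintro m ⟨u, hu, -⟩
    have hinj : Function.Injective (fun i : Fin (m + 1) => u i) := fun i j h =>
      Fin.ext (hu i (by omega) j (by omega) h)
    have := Nat.card_le_card_of_injective _ hinj
    simp only [Nat.card_eq_fintype_card, Fintype.card_fin] at this
    omega
  obtain ⟨w₀⟩ := hG.nonempty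
  have hP0 : P 0 := ⟨fun _ => w₀, fun i hi j hj _ => by omega, fun i hi => by omega⟩
  have hmax := Nat.findGreatest_spec (P := P) (Nat.zero_le (Nat.card W)) hP0
  set m := Nat.findGreatest P (Nat.card W) with hm
  have hnot : ¬P (m + 1) := fun h =>
    absurd (Nat.le_findGreatest (hbound _ h) h) (by omega)
  obtain ⟨u, hinj, hadj⟩ := hmax
  refine ⟨m, u, hinj, hadj, ?_⟩
  -- A new neighbour of an end would lengthen the path, and a new neighbour of an inner vertex would
  -- be its third. The path is therefore closed under adjacency.
  have hstep : ∀ x y, G.Adj x y → (∃ i ≤ m, u i = x) → ∃ i ≤ m, u i = y := by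
    rintro x y hxy ⟨i, hi, rfl⟩
    by_contra! hy
    rcases Nat.eq_zero_or_pos i with rfl | hi0
    · refine hnot ⟨fun k => if k = 0 then y else u (k - 1), ?_, ?_⟩
      · intro k hk l hl h
        by_cases hk0 : k = 0 <;> by_cases hl0 : l = 0
        · omega
        · simp only [hk0, hl0, if_true, if_false] at h
          exact absurd h.symm (hy _ (by omega))
        · simp only [hk0, hl0, if_true, if_false] at h
          exact absurd h (hy _ (by omega))
        · simp only [hk0, hl0, if_false] at h
          have := hinj _ (by omega) _ (by omega) h
          omega
      · intro k hk
        by_cases hk0 : k = 0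
        · subst hk0; simpa using hxy.symm
        · obtain ⟨l, rfl⟩ := Nat.exists_eq_succ_of_ne_zero hk0
          simpa using hadj l (by omega)
    · rcases hi.lt_or_eq with him | rfl
      · obtain ⟨l, rfl⟩ := Nat.exists_eq_succ_of_ne_zero hi0.ne'
        rcases hdeg _ _ _ _ (hadj l (by omega)).symm (hadj (l + 1) him) hxy with h | h | h
        · have := hinj _ (by omega) _ (by omega) h
          omega
        · exact hy _ (by omega) h
        · exact hy _ (by omega) h
      · refine hnot ⟨fun k => if k = m + 1 then y else u k, ?_, ?_⟩
        · intro k hk l hl h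
          by_cases hk0 : k = m + 1 <;> by_cases hl0 : l = m + 1
          · omega
          · simp only [hk0, hl0, if_true, if_false] at h
            exact absurd h.symm (hy _ (by omega))
          · simp only [hk0, hl0, if_true, if_false] at h
            exact absurd h (hy _ (by omega))
          · simp only [hk0, hl0, if_false] at h
            exact hinj _ (by omega) _ (by omega) h
        · intro k hk
          by_cases hk0 : k = m
          · subst hk0; simpa using hxy
          · have h1 : k ≠ m + 1 := by omega
            have h2 : k + 1 ≠ m + 1 := by omega
            simp only [h1, h2, if_false]
            exact hadj k (by omega)
  intro w
  obtain ⟨p⟩ := hG.preconnected (u 0) w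
  have : ∀ (x y : W) (q : G.Walk x y), (∃ i ≤ m, u i = x) → ∃ i ≤ m, u i = y := by
    intro x y q
    induction q with
    | nil => exact id
    | cons h _ ih => exact fun hx => ih (hstep _ _ h hx)
  exact this _ _ p ⟨0, Nat.zero_le _, rfl⟩

/-! ### Triangles of a simplicial complex -/

section Complex

variable {V : Type*} [Fintype V] [DecidableEq V] {S : AbstractSimplicialComplex V}

theorem mem_triangles {t : Finset V} : t ∈ triangles S ↔ t ∈ S.faces ∧ t.card = 3 := by
  simp [triangles]

theorem face_of_subset {s t : Finset V} (ht : t ∈ S.faces) (hst : s ⊆ t) (hs : s.Nonempty) :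
    s ∈ S.faces :=
  (S.isRelLowerSet_faces ht).2 hst hs

theorem ne_of_mem_triangles {v a b : V} (h : ({v, a, b} : Finset V) ∈ triangles S) :
    v ≠ a ∧ v ≠ b ∧ a ≠ b := by
  have := (mem_triangles.1 h).2
  refine ⟨?_, ?_, ?_⟩ <;> rintro rfl
  · rw [Finset.insert_eq_of_mem (by simp)] at this
    exact absurd this (Finset.card_le_two.trans_lt (by norm_num)).ne
  · rw [Finset.insert_eq_of_mem (by simp)] at this
    exact absurd this (Finset.card_le_two.trans_lt (by norm_num)).ne
  · rw [Finset.pair_eq_singleton] at this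
    exact absurd this (Finset.card_le_two.trans_lt (by norm_num)).ne

theorem triangles_swap_right {v a b : V} (h : ({v, a, b} : Finset V) ∈ triangles S) :
    ({v, b, a} : Finset V) ∈ triangles S := by
  rwa [Finset.pair_comm b a]

theorem triangles_swap_left {v a b : V} (h : ({v, a, b} : Finset V) ∈ triangles S) :
    ({a, v, b} : Finset V) ∈ triangles S := by
  rwa [Finset.insert_comm a v]

theorem adj_of_mem_triangles {v a b : V} (h : ({v, a, b} : Finset V) ∈ triangles S) :
    (skeleton S).Adj v a :=
  ⟨(ne_of_mem_triangles h).1, face_of_subset (mem_triangles.1 h).1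
    (by intro x; simp only [Finset.mem_insert, Finset.mem_singleton]; tauto) (by simp)⟩

theorem mem_triangles_of_ne {v a b : V} (h : ({v, a, b} : Finset V) ∈ S.faces) (h1 : v ≠ a)
    (h2 : v ≠ b) (h3 : a ≠ b) : ({v, a, b} : Finset V) ∈ triangles S :=
  mem_triangles.2 ⟨h, Finset.card_eq_three.2 ⟨v, a, b, h1, h2, h3, rfl⟩⟩

theorem mem_trianglesThrough_pair {v a : V} (hva : v ≠ a) {t : Finset V} :
    t ∈ trianglesThrough S {v, a} ↔
      ∃ b, ({v, a, b} : Finset V) ∈ triangles S ∧ t = {v, a, b} := by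
  unfold trianglesThrough
  rw [Finset.mem_filter]
  constructor
  · rintro ⟨ht, hsub⟩
    have hc := (mem_triangles.1 ht).2
    have h1 : (t \ {v, a}).card = 1 := by
      rw [Finset.card_sdiff_of_subset hsub, hc, Finset.card_pair hva]
    obtain ⟨b, hb⟩ := Finset.card_eq_one.1 h1
    have : t = {v, a, b} := by
      rw [← Finset.union_sdiff_of_subset hsub, hb]
      ext x; simp only [Finset.mem_union, Finset.mem_insert, Finset.mem_singleton]; tauto
    exact ⟨b, this ▸ ht, this⟩
  · rintro ⟨b, hb, rfl⟩
    refine ⟨hb, ?_⟩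
    intro x; simp only [Finset.mem_insert, Finset.mem_singleton]; tauto

theorem eq_of_triangle_eq {v a b c : V} (h : ({v, a, b} : Finset V) ∈ triangles S)
    (e : ({v, a, b} : Finset V) = {v, a, c}) : b = c := by
  obtain ⟨h1, h2, h3⟩ := ne_of_mem_triangles h
  have : b ∈ ({v, a, c} : Finset V) := by rw [← e]; simp
  simp only [Finset.mem_insert, Finset.mem_singleton] at this
  rcases this with rfl | rfl | rfl
  · exact absurd rfl h2
  · exact absurd rfl h3
  · rfl

end Complex

/-! ### Edges and vertex links of a combinatorial disk -/

section Complex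

variable {V : Type*} [Fintype V] [DecidableEq V] {S : AbstractSimplicialComplex V}

namespace IsCombinatorialClosedDisk

theorem exists_triangle (hS : IsCombinatorialClosedDisk S) {v a : V} (h : (skeleton S).Adj v a) :
    ∃ b, ({v, a, b} : Finset V) ∈ triangles S := by
  have hc := hS.edge _ h.2 (Finset.card_pair h.1)
  have : (trianglesThrough S {v, a}).Nonempty := by
    rw [← Finset.card_pos]; omega
  obtain ⟨t, ht⟩ := this
  obtain ⟨b, hb, -⟩ := (mem_trianglesThrough_pair h.1).1 ht
  exact ⟨b, hb⟩

theorem exists_adj (hS : IsCombinatorialClosedDisk S) (v : V) : ∃ a, (skeleton S).Adj v a := by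
  obtain ⟨⟨a, ha⟩⟩ := (hS.link_connected v).nonempty
  exact ⟨a, ha⟩

/-- An edge lies in at most two triangles. -/
theorem third_vertex (hS : IsCombinatorialClosedDisk S) {v u a b c : V}
    (ha : ({v, u, a} : Finset V) ∈ triangles S) (hb : ({v, u, b} : Finset V) ∈ triangles S)
    (hc : ({v, u, c} : Finset V) ∈ triangles S) : a = b ∨ a = c ∨ b = c := by
  by_contra! hne
  have hvu := adj_of_mem_triangles ha
  have hcard := hS.edge _ hvu.2 (Finset.card_pair hvu.1)
  have : 2 < (trianglesThrough S {v, u}).card := by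
    rw [Finset.two_lt_card]
    refine ⟨{v, u, a}, (mem_trianglesThrough_pair hvu.1).2 ⟨a, ha, rfl⟩,
      {v, u, b}, (mem_trianglesThrough_pair hvu.1).2 ⟨b, hb, rfl⟩,
      {v, u, c}, (mem_trianglesThrough_pair hvu.1).2 ⟨c, hc, rfl⟩,
      fun h => hne.1 (eq_of_triangle_eq ha h), fun h => hne.2.1 (eq_of_triangle_eq ha h),
      fun h => hne.2.2 (eq_of_triangle_eq hb h)⟩
  omega

theorem exists_other_triangle (hS : IsCombinatorialClosedDisk S) {v u a : V}
    (hv : IsInteriorVertex S v) (ha : ({v, u, a} : Finset V) ∈ triangles S) :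
    ∃ b, b ≠ a ∧ ({v, u, b} : Finset V) ∈ triangles S := by
  have hvu := adj_of_mem_triangles ha
  have h2 : (trianglesThrough S {v, u}).card = 2 := by
    refine (hS.edge _ hvu.2 (Finset.card_pair hvu.1)).resolve_left fun h1 => ?_
    exact hv.2 ⟨hv.1, {v, u}, ⟨hvu.2, Finset.card_pair hvu.1, h1⟩, by simp⟩
  obtain ⟨t, ht, hne⟩ := Finset.exists_mem_ne (by omega : 1 < (trianglesThrough S {v, u}).card)
    {v, u, a}
  obtain ⟨b, hb, rfl⟩ := (mem_trianglesThrough_pair hvu.1).1 ht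
  exact ⟨b, fun h => hne (by rw [h]), hb⟩

end IsCombinatorialClosedDisk

theorem singleton_mem_faces (S : AbstractSimplicialComplex V) (v : V) :
    ({v} : Finset V) ∈ S.faces := S.singleton_mem v

theorem isInteriorSimplex_edge {v u a b : V} (ha : ({v, u, a} : Finset V) ∈ triangles S)
    (hb : ({v, u, b} : Finset V) ∈ triangles S) (hab : a ≠ b) :
    IsInteriorSimplex S {v, u} := by
  have hvu := adj_of_mem_triangles ha
  refine ⟨hvu.2, ?_⟩
  rintro ⟨-, e, ⟨-, hc, h1⟩, hsub⟩
  have : ({v, u} : Finset V) = e := Finset.eq_of_subset_of_card_le hsub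
    (by rw [hc, Finset.card_pair hvu.1])
  subst this
  obtain ⟨t, ht⟩ := Finset.card_eq_one.1 h1
  have h2 : ({v, u, a} : Finset V) ∈ trianglesThrough S {v, u} :=
    (mem_trianglesThrough_pair hvu.1).2 ⟨a, ha, rfl⟩
  have h3 : ({v, u, b} : Finset V) ∈ trianglesThrough S {v, u} :=
    (mem_trianglesThrough_pair hvu.1).2 ⟨b, hb, rfl⟩
  rw [ht, Finset.mem_singleton] at h2 h3
  exact hab (eq_of_triangle_eq ha (h2.trans h3.symm))

/-- The vertices `u 0, …, u n` run through the link of `v` so that the triangles at `v` are, without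
repetition, the `v, u i, u (i + 1)` for `i < n`. -/
structure IsLinkEnumeration (S : AbstractSimplicialComplex V) (v : V) (n : ℕ) (u : ℕ → V) :
    Prop where
  pos : 0 < n
  triangle : ∀ i < n, ({v, u i, u (i + 1)} : Finset V) ∈ triangles S
  cover : ∀ a b, ({v, a, b} : Finset V) ∈ triangles S →
    ∃ i < n, (a = u i ∧ b = u (i + 1)) ∨ (a = u (i + 1) ∧ b = u i)
  inj_left : ∀ i < n, ∀ j < n, u i = u j → i = j
  inj_right : ∀ i < n, ∀ j < n, u (i + 1) = u (j + 1) → i = j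

/-- The link of a vertex is a path or, precisely at interior vertices, a cycle. -/
theorem IsCombinatorialClosedDisk.exists_linkEnumeration (hS : IsCombinatorialClosedDisk S)
    (v : V) : ∃ n u, IsLinkEnumeration S v n u ∧
      ((¬IsInteriorVertex S v ∧ ∀ i ≤ n, ∀ j ≤ n, u i = u j → i = j) ∨
        (IsInteriorVertex S v ∧ u n = u 0 ∧ 3 ≤ n)) := by
  have hadj : ∀ x y : {u : V // (skeleton S).Adj v u},
      (linkGraph S v).Adj x y ↔ ({v, x.1, y.1} : Finset V) ∈ triangles S := by
    intro x y
    constructor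
    · rintro ⟨h1, h2⟩
      exact mem_triangles_of_ne h2 x.2.1 y.2.1 fun h => h1 (Subtype.ext h)
    · intro h
      exact ⟨fun e => (ne_of_mem_triangles h).2.2 (congrArg Subtype.val e), (mem_triangles.1 h).1⟩
  have hdeg : ∀ u a b c : {u : V // (skeleton S).Adj v u}, (linkGraph S v).Adj u a →
      (linkGraph S v).Adj u b → (linkGraph S v).Adj u c → a = b ∨ a = c ∨ b = c := by
    intro u a b c ha hb hc
    rw [hadj] at ha hb hc
    simp only [Subtype.ext_iff]
    exact hS.third_vertex ha hb hc
  obtain ⟨m, w, hinj, hcons, hsurj⟩ := (hS.link_connected v).exists_hamiltonian_list hdeg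
  -- A chord would give a third neighbour to an inner vertex of the path, so the only possible
  -- additional edge joins its ends.
  have hlt : ∀ i j, i < j → j ≤ m → (linkGraph S v).Adj (w i) (w j) →
      j = i + 1 ∨ (i = 0 ∧ j = m) := by
    intro i j hij hjm h
    by_contra! hne
    obtain ⟨hne1, hne2⟩ := hne
    by_cases hi : i = 0
    · have hj : j ≠ m := hne2 hi
      obtain ⟨l, rfl⟩ := Nat.exists_eq_succ_of_ne_zero (show j ≠ 0 by omega)
      rcases hdeg _ _ _ _ (hcons l (by omega)).symm (hcons (l + 1) (by omega)) h.symm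
        with e | e | e
      · have := hinj _ (by omega) _ (by omega) e; omega
      · have := hinj _ (by omega) _ (by omega) e; omega
      · have := hinj _ (by omega) _ (by omega) e; omega
    · obtain ⟨l, rfl⟩ := Nat.exists_eq_succ_of_ne_zero hi
      rcases hdeg _ _ _ _ (hcons l (by omega)).symm (hcons (l + 1) (by omega)) h with e | e | e
      · have := hinj _ (by omega) _ (by omega) e; omega
      · have := hinj _ (by omega) _ (by omega) e; omega
      · have := hinj _ (by omega) _ (by omega) e; omega
  have hm : 0 < m := by
    obtain ⟨b, hb⟩ := hS.exists_triangle (w 0).2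
    obtain ⟨i, hi, e⟩ := hsurj ⟨b, adj_of_mem_triangles (triangles_swap_right hb)⟩
    rcases Nat.eq_zero_or_pos m with rfl | h
    · obtain rfl : i = 0 := by omega
      exact absurd (congrArg Subtype.val e) (ne_of_mem_triangles hb).2.2
    · exact h
  have hinj' : ∀ i ≤ m, ∀ j ≤ m, (w i).1 = (w j).1 → i = j := fun i hi j hj h =>
    hinj i hi j hj (Subtype.ext h)
  -- The condition `2 ≤ m` separates a genuine closing edge from the single edge of a path with `m =
  -- 1`.
  have hcover : ∀ a b, ({v, a, b} : Finset V) ∈ triangles S →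
      (∃ i < m, (a = (w i).1 ∧ b = (w (i + 1)).1) ∨ (a = (w (i + 1)).1 ∧ b = (w i).1)) ∨
      ((linkGraph S v).Adj (w 0) (w m) ∧ 2 ≤ m ∧
        ((a = (w m).1 ∧ b = (w 0).1) ∨ (a = (w 0).1 ∧ b = (w m).1))) := by
    intro a b h
    obtain ⟨i, hi, ei⟩ := hsurj ⟨a, adj_of_mem_triangles h⟩
    obtain ⟨j, hj, ej⟩ := hsurj ⟨b, adj_of_mem_triangles (triangles_swap_right h)⟩
    have ea : a = (w i).1 := by rw [ei]
    have eb : b = (w j).1 := by rw [ej]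
    have hadj' : (linkGraph S v).Adj (w i) (w j) := by
      rw [hadj, ei, ej]; exact h
    rcases lt_trichotomy i j with hij | rfl | hij
    · rcases hlt i j hij hj hadj' with rfl | ⟨rfl, rfl⟩
      · exact Or.inl ⟨i, by omega, Or.inl ⟨ea, eb⟩⟩
      · by_cases h1 : j = 1
        · subst h1; exact Or.inl ⟨0, by omega, Or.inl ⟨ea, eb⟩⟩
        · exact Or.inr ⟨hadj', by omega, Or.inr ⟨ea, eb⟩⟩
    · exact absurd hadj' (linkGraph S v).irrefl
    · rcases hlt j i hij hi hadj'.symm with rfl | ⟨rfl, rfl⟩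
      · exact Or.inl ⟨j, by omega, Or.inr ⟨ea, eb⟩⟩
      · by_cases h1 : i = 1
        · subst h1; exact Or.inl ⟨0, by omega, Or.inr ⟨ea, eb⟩⟩
        · exact Or.inr ⟨hadj'.symm, by omega, Or.inl ⟨ea, eb⟩⟩
  by_cases hclosed : (linkGraph S v).Adj (w 0) (w m) ∧ 2 ≤ m
  · obtain ⟨hc, hm2⟩ := hclosed
    have hu : ∀ i ≤ m, (if i ≤ m then (w i).1 else (w 0).1) = (w i).1 := fun i hi => if_pos hi
    have hu' : (if m + 1 ≤ m then (w (m + 1)).1 else (w 0).1) = (w 0).1 := if_neg (by omega)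
    -- The default value `w 0` beyond `m` makes the closing edge the last of `m + 1` consecutive
    -- pairs.
    have enum : IsLinkEnumeration S v (m + 1) fun i => if i ≤ m then (w i).1 else (w 0).1 := by
      refine ⟨by omega, ?_, ?_, ?_, ?_⟩
      · intro i hi
        rw [hu i (by omega)]
        rcases (show i ≤ m by omega).lt_or_eq with h | rfl
        · rw [hu _ h]; exact (hadj _ _).1 (hcons i h)
        · rw [hu']; exact (hadj _ _).1 hc.symm
      · intro a b h
        rcases hcover a b h with ⟨i, hi, e⟩ | ⟨-, -, e⟩
        · refine ⟨i, by omega, ?_⟩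
          rwa [hu i (by omega), hu (i + 1) (by omega)]
        · refine ⟨m, by omega, ?_⟩
          rwa [hu m le_rfl, hu']
      · intro i hi j hj h
        beta_reduce at h
        rw [hu i (by omega), hu j (by omega)] at h
        exact hinj' i (by omega) j (by omega) h
      · intro i hi j hj h
        beta_reduce at h
        rcases (show i ≤ m by omega).lt_or_eq with h1 | h1 <;>
        rcases (show j ≤ m by omega).lt_or_eq with h2 | h2
        · rw [hu _ h1, hu _ h2] at h
          have := hinj' _ h1 _ h2 h; omega
        · rw [h2, hu _ h1, hu'] at h
          have := hinj' _ h1 _ (by omega) h; omega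
        · rw [h1, hu', hu _ h2] at h
          have := hinj' _ (by omega) _ h2 h; omega
        · exact h1.trans h2.symm
    refine ⟨m + 1, _, enum, Or.inr ⟨⟨singleton_mem_faces S v, ?_⟩, ?_, by omega⟩⟩
    · rintro ⟨-, e, ⟨he, hc2, h1⟩, hsub⟩
      obtain ⟨x, y, hxy, rfl⟩ := Finset.card_eq_two.1 hc2
      -- In a cycle each vertex has two distinct neighbours, so every edge at `v` lies in two
      -- triangles and `v` is interior.
      have key : ∀ a, (skeleton S).Adj v a → (trianglesThrough S {v, a}).card ≠ 1 := by
        intro a ha h1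
        obtain ⟨i, hi, e⟩ := hsurj ⟨a, ha⟩
        obtain ⟨b, c, hbc, h2, h3⟩ : ∃ b c, b ≠ c ∧ ({v, a, b} : Finset V) ∈ triangles S ∧
            ({v, a, c} : Finset V) ∈ triangles S := by
          have ea : a = (w i).1 := by rw [e]
          subst ea
          have aux : ∀ j k, j ≤ m → k ≤ m → j ≠ k → (linkGraph S v).Adj (w i) (w j) →
              (linkGraph S v).Adj (w i) (w k) →
              ∃ b c, b ≠ c ∧ ({v, (w i).1, b} : Finset V) ∈ triangles S ∧
              ({v, (w i).1, c} : Finset V) ∈ triangles S := fun j k hj hk hjk h h' =>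
            ⟨w j, w k, fun e => hjk (hinj' j hj k hk e), (hadj _ _).1 h, (hadj _ _).1 h'⟩
          rcases Nat.eq_zero_or_pos i with rfl | h0
          · exact aux 1 m (by omega) le_rfl (by omega) (hcons 0 hm) hc
          · obtain ⟨l, rfl⟩ := Nat.exists_eq_succ_of_ne_zero h0.ne'
            rcases hi.lt_or_eq with h | h
            · exact aux l (l + 2) (by omega) (by omega) (by omega) (hcons l (by omega)).symm
                (hcons _ h)
            · subst h
              exact aux l 0 (by omega) (by omega) (by omega) (hcons l (by omega)).symm hc.symm
        exact (isInteriorSimplex_edge h2 h3 hbc).2 ⟨ha.2, _, ⟨ha.2, Finset.card_pair ha.1, h1⟩,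
          subset_rfl⟩
      have hv : v = x ∨ v = y := by simpa using hsub
      rcases hv with rfl | rfl
      · exact key y ⟨hxy, he⟩ h1
      · rw [Finset.pair_comm] at h1 he
        exact key x ⟨hxy.symm, he⟩ h1
    · rw [hu', hu 0 (by omega)]
  · have hcover' : ∀ a b, ({v, a, b} : Finset V) ∈ triangles S →
        ∃ i < m, (a = (w i).1 ∧ b = (w (i + 1)).1) ∨ (a = (w (i + 1)).1 ∧ b = (w i).1) :=
      fun a b h => (hcover a b h).resolve_right fun h' => hclosed ⟨h'.1, h'.2.1⟩
    refine ⟨m, fun i => (w i).1, ⟨hm, fun i hi => (hadj _ _).1 (hcons i hi), hcover',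
      fun i hi j hj h => hinj' i hi.le j hj.le h, fun i hi j hj h => ?_⟩, Or.inl ⟨?_, hinj'⟩⟩
    · have := hinj' (i + 1) hi (j + 1) hj h; omega
    · intro hv
      -- At the end `w 0` of an open path the edge to `v` lies in a single triangle, which an
      -- interior vertex does not allow.
      obtain ⟨b, hb, hb'⟩ := hS.exists_other_triangle hv ((hadj _ _).1 (hcons 0 hm))
      obtain ⟨i, hi, h | h⟩ := hcover' _ _ hb'
      · have := hinj' 0 (by omega) i (by omega) h.1
        subst this
        exact hb h.2
      · have := hinj' 0 (by omega) (i + 1) (by omega) h.1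
        omega

/-! ### Holonomy -/

section Holonomy

variable {G : Type*} [Group G]

/-- The product of the transition elements along a walk. -/
def walkHolonomy (S : AbstractSimplicialComplex V) (g : V → V → G) :
    ∀ {u v : V}, (skeleton S).Walk u v → G
  | _, _, .nil => 1
  | u, _, .cons (v := v) _ p => g u v * walkHolonomy S g p

theorem walkHolonomy_append (g : V → V → G) {u v w : V} (p : (skeleton S).Walk u v)
    (q : (skeleton S).Walk v w) :
    walkHolonomy S g (p.append q) = walkHolonomy S g p * walkHolonomy S g q := by
  induction p with
  | nil => simp [walkHolonomy]
  | cons h p ih => simp [walkHolonomy, ih, mul_assoc]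

/-- The two hypotheses on `g` are invariance under the two elementary moves that generate homotopy.
-/
theorem EdgeHomotopic.walkHolonomy_eq {g : V → V → G}
    (hinv : ∀ u v, (skeleton S).Adj u v → g u v * g v u = 1)
    (htri : ∀ u v w, ({u, v, w} : Finset V) ∈ triangles S → g u v * g v w = g u w)
    {u v : V} {p q : (skeleton S).Walk u v} (h : EdgeHomotopic S p q) :
    walkHolonomy S g p = walkHolonomy S g q := by
  induction h with
  | refl => rfl
  | symm _ ih => exact ih.symm
  | trans _ _ ih ih' => exact ih.trans ih'
  | cons h _ ih => simp only [walkHolonomy, ih]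
  | backtrack h h' p => simp only [walkHolonomy, ← mul_assoc, hinv _ _ h, one_mul]
  | triangle huv hvw huw ht p =>
    simp only [walkHolonomy, ← mul_assoc,
      htri _ _ _ (mem_triangles_of_ne ht huv.1 huw.1 hvw.1)]

/-- On a simply connected complex, flat transition elements come from a function on vertices. -/
theorem IsCombinatorialClosedDisk.exists_potential (hS : IsCombinatorialClosedDisk S)
    {g : V → V → G} (hinv : ∀ u v, (skeleton S).Adj u v → g u v * g v u = 1)
    (htri : ∀ u v w, ({u, v, w} : Finset V) ∈ triangles S → g u v * g v w = g u w) :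
    ∃ h : V → G, ∀ u v, (skeleton S).Adj u v → h v = h u * g u v := by
  obtain ⟨o⟩ := hS.connected.nonempty
  have p : ∀ v, (skeleton S).Walk o v := fun v => (hS.connected.preconnected o v).some
  refine ⟨fun v => walkHolonomy S g (p v), fun u v huv => ?_⟩
  -- The loops `p u`, edge, `p v` reversed and `p v`, `p v` reversed both have trivial holonomy;
  -- their common tail cancels.
  have h1 := (hS.simply_connected o ((p u).append (.cons huv (p v).reverse))).walkHolonomy_eq
    hinv htri
  have h2 := (hS.simply_connected o ((p v).append (p v).reverse)).walkHolonomy_eq hinv htri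
  simp only [walkHolonomy_append, walkHolonomy] at h1 h2
  rw [← mul_assoc] at h1
  exact mul_right_cancel (h2.trans h1.symm)

end Holonomy

end Complex

section Complex

variable {V : Type*} [Fintype V] [DecidableEq V] {S : AbstractSimplicialComplex V}

/-! ### Developments -/

/-- `ℓ` assigns to the edges of `S` lengths that satisfy the strict triangle inequalities. -/
structure IsLengthFunction (S : AbstractSimplicialComplex V) (ℓ : V → V → ℝ) : Prop where
  symm : ∀ v w, ℓ v w = ℓ w v
  triangle : ∀ u v w, ({u, v, w} : Finset V) ∈ triangles S → ℓ u w < ℓ u v + ℓ v w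

theorem IsLengthFunction.pos {ℓ : V → V → ℝ} (hℓ : IsLengthFunction S ℓ) {v a b : V}
    (h : ({v, a, b} : Finset V) ∈ triangles S) : 0 < ℓ v a := by
  have h1 := hℓ.triangle v a b h
  have h2 := hℓ.triangle a v b (triangles_swap_left h)
  rw [hℓ.symm a v] at h2
  linarith

/-- `q` places the triangles through the edge `v w` in the plane, with the side lengths `ℓ` and on
different sides of the edge. -/
structure IsEdgeDevelopment (S : AbstractSimplicialComplex V) (ℓ : V → V → ℝ) (v w : V)
    (q : V → Plane) : Prop where
  dist : ∀ b, ({v, w, b} : Finset V) ∈ triangles S →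
    dist (q v) (q w) = ℓ v w ∧ dist (q v) (q b) = ℓ v b ∧ dist (q w) (q b) = ℓ w b
  opposite : ∀ b c, ({v, w, b} : Finset V) ∈ triangles S → ({v, w, c} : Finset V) ∈ triangles S →
    b ≠ c → crossAt (q v) (q w) (q b) * crossAt (q v) (q w) (q c) < 0

/-- `q` places the triangles at `v` in the plane, with the side lengths `ℓ` and so that triangles
with a common edge lie on different sides of it. -/
def IsStarDevelopment (S : AbstractSimplicialComplex V) (ℓ : V → V → ℝ) (v : V)
    (q : V → Plane) : Prop :=
  ∀ w, IsEdgeDevelopment S ℓ v w q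

namespace IsEdgeDevelopment

variable {ℓ : V → V → ℝ} {v w : V} {q q' : V → Plane}

theorem symm (h : IsEdgeDevelopment S ℓ v w q) (hℓ : IsLengthFunction S ℓ) :
    IsEdgeDevelopment S ℓ w v q := by
  refine ⟨fun b hb => ?_, fun b c hb hc hbc => ?_⟩
  · obtain ⟨h1, h2, h3⟩ := h.dist b (triangles_swap_left hb)
    exact ⟨by rw [dist_comm, h1, hℓ.symm], h3, h2⟩
  · rw [crossAt_swap_left, crossAt_swap_left (q v), neg_mul_neg]
    exact h.opposite b c (triangles_swap_left hb) (triangles_swap_left hc) hbc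

theorem crossAt_ne_zero (h : IsEdgeDevelopment S ℓ v w q) (hℓ : IsLengthFunction S ℓ) {b : V}
    (hb : ({v, w, b} : Finset V) ∈ triangles S) : crossAt (q v) (q w) (q b) ≠ 0 := by
  obtain ⟨h1, h2, h3⟩ := h.dist b hb
  have t1 := hℓ.triangle _ _ _ (triangles_swap_right hb)
  have t2 := hℓ.triangle _ _ _ hb
  have t3 := hℓ.triangle _ _ _ (triangles_swap_left hb)
  apply crossAt_ne_zero_of_strict_triangle
  · rw [dist_comm (q b), h1, h2, h3, hℓ.symm w b]; exact t1
  · rw [h1, h2, h3]; exact t2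
  · rw [dist_comm (q w) (q v), h1, h2, h3, hℓ.symm v w]; exact t3

/-- Opposite sides are preserved even by reflections, because the product of the two signed areas
depends only on distances. -/
theorem map (h : IsEdgeDevelopment S ℓ v w q) (g : Plane ≃ᵢ Plane)
    (hg : ∀ b, ({v, w, b} : Finset V) ∈ triangles S →
      g (q v) = q' v ∧ g (q w) = q' w ∧ g (q b) = q' b) :
    IsEdgeDevelopment S ℓ v w q' := by
  refine ⟨fun b hb => ?_, fun b c hb hc hbc => ?_⟩
  · obtain ⟨h1, h2, h3⟩ := hg b hb
    rw [← h1, ← h2, ← h3, g.dist_eq, g.dist_eq, g.dist_eq]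
    exact h.dist b hb
  · obtain ⟨h1, h2, h3⟩ := hg b hb
    rw [← h1, ← h2, ← h3, ← (hg c hc).2.2]
    have := h.opposite b c hb hc hbc
    simpa only [crossAt_mul_crossAt, dotAt_eq_dist, g.dist_eq] using this

/-- Two developments of an edge differ by an isometry. -/
theorem exists_isometryEquiv (h : IsEdgeDevelopment S ℓ v w q)
    (h' : IsEdgeDevelopment S ℓ v w q') (hℓ : IsLengthFunction S ℓ) :
    ∃ g : Plane ≃ᵢ Plane, ∀ b, ({v, w, b} : Finset V) ∈ triangles S →
      g (q v) = q' v ∧ g (q w) = q' w ∧ g (q b) = q' b := by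
  by_cases hex : ∃ b, ({v, w, b} : Finset V) ∈ triangles S
  · obtain ⟨b, hb⟩ := hex
    obtain ⟨h1, h2, h3⟩ := h.dist b hb
    obtain ⟨k1, k2, k3⟩ := h'.dist b hb
    obtain ⟨c, s, ε, d, hcs, hε, e1, e2, e3⟩ := exists_planarIsometry (h.crossAt_ne_zero hℓ hb)
      (h1.trans k1.symm) (h2.trans k2.symm) (h3.trans k3.symm)
    refine ⟨planarIsometry c s ε d hcs hε, fun x hx => ⟨e1, e2, ?_⟩⟩
    by_cases hxb : b = x
    · rw [← hxb]; exact e3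
    · obtain ⟨-, m2, m3⟩ := h.dist x hx
      obtain ⟨-, n2, n3⟩ := h'.dist x hx
      exact IsometryEquiv.map_eq_of_opposite _ e1 e2 e3 (m2.trans n2.symm) (m3.trans n3.symm)
        (h.opposite b x hb hx hxb) (h'.opposite b x hb hx hxb)
  · exact ⟨IsometryEquiv.refl _, fun b hb => absurd ⟨b, hb⟩ hex⟩

end IsEdgeDevelopment

/-- Star developments at all vertices can be glued to a development of the disk. -/
theorem IsCombinatorialClosedDisk.exists_development (hS : IsCombinatorialClosedDisk S)
    {ℓ : V → V → ℝ} (hℓ : IsLengthFunction S ℓ) (hq : ∀ v, ∃ q, IsStarDevelopment S ℓ v q) :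
    ∃ p : V → Plane, ∀ v, IsStarDevelopment S ℓ v p := by
  choose q hq using hq
  -- `g v w` carries the layout `q w` to the layout `q v` on the triangles through the edge `v w`.
  -- Agreement on one triangle determines an isometry, which yields the cocycle relations below.
  choose g hg using fun v w =>
    ((hq w v).symm hℓ).exists_isometryEquiv (hq v w) hℓ
  have hinv : ∀ u v, (skeleton S).Adj u v → g u v * g v u = 1 := by
    intro u v huv
    obtain ⟨b, hb⟩ := hS.exists_triangle huv
    obtain ⟨h1, h2, h3⟩ := hg u v b hb
    obtain ⟨k1, k2, k3⟩ := hg v u b (triangles_swap_left hb)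
    refine isometryEquiv_eq_of_three ((hq u v).crossAt_ne_zero hℓ hb) ?_ ?_ ?_
    · change g u v (g v u (q u u)) = q u u
      rw [k2, h1]
    · change g u v (g v u (q u v)) = q u v
      rw [k1, h2]
    · change g u v (g v u (q u b)) = q u b
      rw [k3, h3]
  have htri : ∀ u v w, ({u, v, w} : Finset V) ∈ triangles S → g u v * g v w = g u w := by
    intro u v w h
    obtain ⟨h1, h2, h3⟩ := hg u v w h
    obtain ⟨k1, k2, k3⟩ := hg v w u (triangles_swap_right (triangles_swap_left h))
    obtain ⟨m1, m2, m3⟩ := hg u w v (triangles_swap_right h)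
    refine isometryEquiv_eq_of_three ((hq w u).crossAt_ne_zero hℓ
      (triangles_swap_left (triangles_swap_right h))) ?_ ?_ ?_
    · change g u v (g v w (q w w)) = g u w (q w w)
      rw [k2, h3, m2]
    · change g u v (g v w (q w u)) = g u w (q w u)
      rw [k3, h1, m1]
    · change g u v (g v w (q w v)) = g u w (q w v)
      rw [k1, h2, m3]
  obtain ⟨h, hh⟩ := hS.exists_potential hinv htri
  have hstep : ∀ u v b, ({u, v, b} : Finset V) ∈ triangles S → h u (q u v) = h v (q v v) := by
    intro u v b hb
    rw [hh u v (adj_of_mem_triangles hb)]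
    change _ = h u (g u v (q v v))
    rw [(hg u v b hb).2.1]
  -- Each vertex is placed by its own star, moved by the potential; `hstep` shows that a
  -- neighbouring star gives the same position.
  refine ⟨fun v => h v (q v v), fun v w => (hq v w).map (h v) fun b hb => ⟨rfl, ?_, ?_⟩⟩
  · exact hstep v w b hb
  · exact hstep v b w (triangles_swap_right hb)

/-- Two developments of the disk differ by an isometry. -/
theorem IsCombinatorialClosedDisk.development_unique (hS : IsCombinatorialClosedDisk S)
    {ℓ : V → V → ℝ} (hℓ : IsLengthFunction S ℓ) {p p' : V → Plane}
    (hp : ∀ v, IsStarDevelopment S ℓ v p) (hp' : ∀ v, IsStarDevelopment S ℓ v p') :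
    ∃ g : Plane ≃ᵢ Plane, ∀ v, p' v = g (p v) := by
  choose g hg using fun v w => (hp v w).exists_isometryEquiv (hp' v w) hℓ
  have hsymm : ∀ v w b, ({v, w, b} : Finset V) ∈ triangles S → g v w = g w v := by
    intro v w b hb
    obtain ⟨h1, h2, h3⟩ := hg v w b hb
    obtain ⟨k1, k2, k3⟩ := hg w v b (triangles_swap_left hb)
    exact isometryEquiv_eq_of_three ((hp v w).crossAt_ne_zero hℓ hb) (h1.trans k2.symm)
      (h2.trans k1.symm) (h3.trans k3.symm)
  have hlink : ∀ v w b, ({v, w, b} : Finset V) ∈ triangles S → g v w = g v b := by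
    intro v w b hb
    obtain ⟨h1, h2, h3⟩ := hg v w b hb
    obtain ⟨k1, k2, k3⟩ := hg v b w (triangles_swap_right hb)
    exact isometryEquiv_eq_of_three ((hp v w).crossAt_ne_zero hℓ hb) (h1.trans k1.symm)
      (h2.trans k3.symm) (h3.trans k2.symm)
  -- The comparing isometry is constant along the link of `v`, and below along edges of `S`; hence
  -- it is constant.
  have hstar : ∀ v (x y : {u : V // (skeleton S).Adj v u}), g v x = g v y := by
    intro v x y
    obtain ⟨r⟩ := (hS.link_connected v).preconnected x y
    induction r with
    | nil => rfl
    | @cons a b _ h _ ih =>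
      rw [← ih]
      exact hlink v a b (mem_triangles_of_ne h.2 a.2.1 b.2.1 fun e => h.1 (Subtype.ext e))
  choose n hn using hS.exists_adj
  have hconst : ∀ v w, g v (n v) = g w (n w) := by
    intro v w
    obtain ⟨r⟩ := hS.connected.preconnected v w
    induction r with
    | nil => rfl
    | @cons a b _ h _ ih =>
      rw [← ih, hstar a ⟨n a, hn a⟩ ⟨b, h⟩, hstar b ⟨n b, hn b⟩ ⟨a, h.symm⟩]
      obtain ⟨c, hc⟩ := hS.exists_triangle h
      exact hsymm a b c hc
  obtain ⟨o⟩ := hS.connected.nonempty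
  refine ⟨g o (n o), fun v => ?_⟩
  rw [hconst o v]
  obtain ⟨c, hc⟩ := hS.exists_triangle (hn v)
  exact (hg v (n v) c hc).1.symm

/-! ### Angles -/

/-- The strict triangle inequalities say that the quotient in the law of cosines lies strictly
between `-1` and `1`. -/
theorem angleOfSides_spec {a b c : ℝ} (ha : 0 < a) (hb : 0 < b) (hc : 0 < c) (h1 : a < b + c)
    (h2 : b < a + c) (h3 : c < a + b) :
    0 < angleOfSides a b c ∧ angleOfSides a b c < Real.pi ∧
      2 * a * b * Real.cos (angleOfSides a b c) = a ^ 2 + b ^ 2 - c ^ 2 := by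
  have hab : 0 < 2 * a * b := by positivity
  have hlt : (a ^ 2 + b ^ 2 - c ^ 2) / (2 * a * b) < 1 := by
    rw [div_lt_one hab]; nlinarith
  have hgt : -1 < (a ^ 2 + b ^ 2 - c ^ 2) / (2 * a * b) := by
    rw [lt_div_iff₀ hab]; nlinarith
  refine ⟨Real.arccos_pos.2 hlt, ?_, ?_⟩
  · refine lt_of_le_of_ne (Real.arccos_le_pi _) fun h => ?_
    exact absurd (Real.arccos_eq_pi.1 h) (not_le.2 hgt)
  · rw [angleOfSides, Real.cos_arccos hgt.le hlt.le, mul_div_cancel₀ _ hab.ne']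

theorem angleOfSides_comm (a b c : ℝ) : angleOfSides a b c = angleOfSides b a c := by
  unfold angleOfSides
  rw [add_comm (a ^ 2), mul_assoc, mul_assoc, mul_comm a b]

/-- The angle at `v` of a triangle `v a b` with side lengths `ℓ`. -/
noncomputable def cornerAngle (ℓ : V → V → ℝ) (v a b : V) : ℝ :=
  angleOfSides (ℓ v a) (ℓ v b) (ℓ a b)

theorem IsLengthFunction.cornerAngle_spec {ℓ : V → V → ℝ} (hℓ : IsLengthFunction S ℓ) {v a b : V}
    (h : ({v, a, b} : Finset V) ∈ triangles S) :
    0 < cornerAngle ℓ v a b ∧ cornerAngle ℓ v a b < Real.pi ∧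
      2 * ℓ v a * ℓ v b * Real.cos (cornerAngle ℓ v a b)
        = ℓ v a ^ 2 + ℓ v b ^ 2 - ℓ a b ^ 2 := by
  have t1 := hℓ.triangle _ _ _ (triangles_swap_right h)
  have t2 := hℓ.triangle _ _ _ h
  have t3 := hℓ.triangle _ _ _ (triangles_swap_left h)
  rw [hℓ.symm b a] at t1
  rw [hℓ.symm a v] at t3
  exact angleOfSides_spec (hℓ.pos h) (hℓ.pos (triangles_swap_right h))
    (hℓ.pos (triangles_swap_right (triangles_swap_left h))) t1 t2 (by linarith)

theorem edgeLength_symm (α : V → ℝ) (η : Sym2 V → ℝ) (f : V → ℝ) (v w : V) :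
    edgeLength α η f v w = edgeLength α η f w v := by
  unfold edgeLength edgeLengthSq
  rw [Sym2.eq_swap, add_comm (f v), add_comm (α v * _)]

theorem faceAngle_eq_cornerAngle (α : V → ℝ) (η : Sym2 V → ℝ) (f : V → ℝ) {v a b : V}
    (h : ({v, a, b} : Finset V) ∈ triangles S) :
    faceAngle α η f v {v, a, b} = cornerAngle (edgeLength α η f) v a b := by
  obtain ⟨h1, h2, h3⟩ := ne_of_mem_triangles h
  have e : ({v, a, b} : Finset V).erase v = {a, b} :=
    Finset.erase_insert (by simp [h1, h2])
  have ea : ({a, b} : Finset V).erase a = {b} := Finset.erase_insert (by simp [h3])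
  have eb : ({a, b} : Finset V).erase b = {a} := by
    rw [Finset.pair_comm]; exact Finset.erase_insert (by simp [h3.symm])
  rw [faceAngle, if_pos (by simp), e, Finset.sum_pair h3, ea, eb, Finset.sum_singleton,
    Finset.sum_singleton, angleOfSides_comm (edgeLength α η f v b), edgeLength_symm α η f b a]
  unfold cornerAngle
  ring

theorem faceAngle_eq_zero (α : V → ℝ) (η : Sym2 V → ℝ) (f : V → ℝ) {v : V} {t : Finset V}
    (h : v ∉ t) : faceAngle α η f v t = 0 := if_neg h

/-! ### Angle sums and layouts of a star -/

namespace IsLinkEnumeration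

variable {v : V} {n : ℕ} {u : ℕ → V}

/-- An edge of the link traversed in both directions would make the cycle have length at most two.
This is what keeps distinct indices from naming the same triangle. -/
theorem not_swap (h : IsLinkEnumeration S v n u) (hu : u n = u 0) (hn : 3 ≤ n) {i j : ℕ}
    (hi : i < n) (hj : j < n) (h1 : u i = u (j + 1)) (h2 : u j = u (i + 1)) : False := by
  have key : ∀ i < n, ∀ j < n, u i = u (j + 1) → (i = j + 1) ∨ (i = 0 ∧ j + 1 = n) := by
    intro i hi j hj h1
    rcases (show j + 1 ≤ n from hj).lt_or_eq with hj' | hj'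
    · exact Or.inl (h.inj_left _ hi _ hj' h1)
    · rw [hj', hu] at h1
      exact Or.inr ⟨h.inj_left _ hi _ (by omega) h1, hj'⟩
  have := key i hi j hj h1
  have := key j hj i hi h2
  omega

theorem sum_faceAngle (h : IsLinkEnumeration S v n u) (hu : u n = u 0) (hn : 3 ≤ n) (α : V → ℝ)
    (η : Sym2 V → ℝ) (f : V → ℝ) :
    ∑ t ∈ triangles S, faceAngle α η f v t
      = ∑ i ∈ Finset.range n, cornerAngle (edgeLength α η f) v (u i) (u (i + 1)) := by
  rw [← Finset.sum_filter_of_ne (p := fun t => v ∈ t)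
    (fun t _ ht => by_contra fun hv => ht (faceAngle_eq_zero α η f hv))]
  symm
  refine Finset.sum_bij (fun i _ => {v, u i, u (i + 1)}) ?_ ?_ ?_ ?_
  · intro i hi
    simp [h.triangle i (Finset.mem_range.1 hi)]
  · intro i hi j hj e
    rw [Finset.mem_range] at hi hj
    have hti := h.triangle i hi
    have htj := h.triangle j hj
    have h1 : u i ∈ ({v, u j, u (j + 1)} : Finset V) := by rw [← e]; simp
    have h2 : u j ∈ ({v, u i, u (i + 1)} : Finset V) := by rw [e]; simp
    simp only [Finset.mem_insert, Finset.mem_singleton] at h1 h2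
    rcases h1 with h1 | h1 | h1
    · exact absurd h1.symm (ne_of_mem_triangles hti).1
    · exact h.inj_left i hi j hj h1
    rcases h2 with h2 | h2 | h2
    · exact absurd h2.symm (ne_of_mem_triangles htj).1
    · exact (h.inj_left j hj i hi h2).symm
    exact (h.not_swap hu hn hi hj h1 h2).elim
  · intro t ht
    rw [Finset.mem_filter] at ht
    obtain ⟨ht, hv⟩ := ht
    obtain ⟨a, b, hab, e⟩ := Finset.card_eq_two.1
      (by rw [Finset.card_erase_of_mem hv, (mem_triangles.1 ht).2] : (t.erase v).card = 2)
    have et : t = {v, a, b} := by rw [← Finset.insert_erase hv, e]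
    subst et
    obtain ⟨i, hi, ⟨rfl, rfl⟩ | ⟨rfl, rfl⟩⟩ := h.cover a b ht
    · exact ⟨i, Finset.mem_range.2 hi, rfl⟩
    · exact ⟨i, Finset.mem_range.2 hi, by rw [Finset.pair_comm]⟩
  · intro i hi
    exact (faceAngle_eq_cornerAngle α η f (h.triangle i (Finset.mem_range.1 hi))).symm

theorem ne_center (h : IsLinkEnumeration S v n u) {i : ℕ} (hi : i ≤ n) : u i ≠ v := by
  rcases hi.lt_or_eq with hi | rfl
  · exact (ne_of_mem_triangles (h.triangle i hi)).1.symm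
  · obtain ⟨m, rfl⟩ := Nat.exists_eq_succ_of_ne_zero h.pos.ne'
    exact (ne_of_mem_triangles (h.triangle m (Nat.lt_succ_self m))).2.1.symm

theorem length_pos (h : IsLinkEnumeration S v n u) {ℓ : V → V → ℝ} (hℓ : IsLengthFunction S ℓ)
    {i : ℕ} (hi : i ≤ n) : 0 < ℓ v (u i) := by
  rcases hi.lt_or_eq with hi | rfl
  · exact hℓ.pos (h.triangle i hi)
  · obtain ⟨m, rfl⟩ := Nat.exists_eq_succ_of_ne_zero h.pos.ne'
    exact hℓ.pos (triangles_swap_right (h.triangle m (Nat.lt_succ_self m)))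

/-- The star of a boundary vertex, and the star of an interior vertex with angle sum `2π`, can be
laid out in the plane. -/
theorem exists_starDevelopment (h : IsLinkEnumeration S v n u) {ℓ : V → V → ℝ}
    (hℓ : IsLengthFunction S ℓ)
    (hflat : (∀ i ≤ n, ∀ j ≤ n, u i = u j → i = j) ∨
      (u n = u 0 ∧ ∑ i ∈ Finset.range n, cornerAngle ℓ v (u i) (u (i + 1)) = 2 * Real.pi)) :
    ∃ q, IsStarDevelopment S ℓ v q := by
  set a : ℕ → ℝ := fun k => ∑ i ∈ Finset.range k, cornerAngle ℓ v (u i) (u (i + 1)) with ha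
  have hsucc : ∀ k, a (k + 1) = a k + cornerAngle ℓ v (u k) (u (k + 1)) := fun k =>
    Finset.sum_range_succ _ _
  set Q : ℕ → Plane := fun k =>
    !₂[ℓ v (u k) * Real.cos (a k), ℓ v (u k) * Real.sin (a k)] with hQ
  have hQwd : ∀ i ≤ n, ∀ j ≤ n, u i = u j → Q i = Q j := by
    -- The only possible repetition is `u n = u 0`, where the polar angles differ by the full angle
    -- sum `2π`.
    rcases hflat with hinj | ⟨hun, hsum⟩
    · intro i hi j hj e; rw [hinj i hi j hj e]
    · have hn0 : Q n = Q 0 := by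
        have e0 : a 0 = 0 := Finset.sum_range_zero _
        have en : a n = 2 * Real.pi := hsum
        simp only [hQ, hun, e0, en, Real.cos_two_pi, Real.cos_zero, Real.sin_two_pi,
          Real.sin_zero]
      intro i hi j hj e
      rcases hi.lt_or_eq with hi | rfl <;> rcases hj.lt_or_eq with hj | rfl
      · rw [h.inj_left i hi j hj e]
      · rw [hun] at e
        rw [h.inj_left i hi 0 h.pos e, hn0]
      · rw [hun] at e
        rw [← h.inj_left 0 h.pos j hj e, hn0]
      · rfl
  classical
  -- The default value also places the centre `v`, which is not in its own link, at the origin.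
  set q : V → Plane := fun w => if hw : ∃ i ≤ n, u i = w then Q hw.choose else !₂[0, 0] with hqdef
  have hqu : ∀ i ≤ n, q (u i) = Q i := by
    intro i hi
    have hw : ∃ j ≤ n, u j = u i := ⟨i, hi, rfl⟩
    simp only [hqdef, dif_pos hw]
    exact hQwd _ hw.choose_spec.1 _ hi hw.choose_spec.2
  have hqv : q v = !₂[0, 0] := by
    simp only [hqdef]
    rw [dif_neg]
    rintro ⟨i, hi, e⟩
    exact h.ne_center hi e
  have hdv : ∀ i ≤ n, dist (q v) (q (u i)) = ℓ v (u i) := by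
    intro i hi
    rw [hqu i hi, hqv, Plane.dist_eq_iff (h.length_pos hℓ hi).le]
    change (0 - ℓ v (u i) * Real.cos (a i)) ^ 2 + (0 - ℓ v (u i) * Real.sin (a i)) ^ 2 = _
    linear_combination ℓ v (u i) ^ 2 * Real.sin_sq_add_cos_sq (a i)
  have hdd : ∀ i < n, dist (q (u i)) (q (u (i + 1))) = ℓ (u i) (u (i + 1)) := by
    intro i hi
    have hp := hℓ.pos (triangles_swap_right (triangles_swap_left (h.triangle i hi)))
    rw [hqu i hi.le, hqu (i + 1) hi, Plane.dist_eq_iff hp.le]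
    have hcos := (hℓ.cornerAngle_spec (h.triangle i hi)).2.2
    have e := Real.cos_sub (a (i + 1)) (a i)
    rw [hsucc, add_sub_cancel_left, ← hsucc] at e
    change (ℓ v (u i) * Real.cos (a i) - ℓ v (u (i + 1)) * Real.cos (a (i + 1))) ^ 2
      + (ℓ v (u i) * Real.sin (a i) - ℓ v (u (i + 1)) * Real.sin (a (i + 1))) ^ 2 = _
    linear_combination ℓ v (u i) ^ 2 * Real.sin_sq_add_cos_sq (a i)
      + ℓ v (u (i + 1)) ^ 2 * Real.sin_sq_add_cos_sq (a (i + 1))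
      + 2 * ℓ v (u i) * ℓ v (u (i + 1)) * e - hcos
  have hcr : ∀ i < n, 0 < crossAt (q v) (q (u i)) (q (u (i + 1))) := by
    intro i hi
    rw [hqu i hi.le, hqu (i + 1) hi, hqv]
    have e := Real.sin_sub (a (i + 1)) (a i)
    rw [hsucc, add_sub_cancel_left, ← hsucc] at e
    obtain ⟨h1, h2, -⟩ := hℓ.cornerAngle_spec (h.triangle i hi)
    have hsin := Real.sin_pos_of_pos_of_lt_pi h1 h2
    have hr := h.length_pos hℓ hi.le
    have hr' := h.length_pos hℓ (show i + 1 ≤ n from hi)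
    have : crossAt !₂[0, 0] (Q i) (Q (i + 1)) = ℓ v (u i) * ℓ v (u (i + 1)) *
        Real.sin (cornerAngle ℓ v (u i) (u (i + 1))) := by
      rw [e]
      change (ℓ v (u i) * Real.cos (a i) - 0) * (ℓ v (u (i + 1)) * Real.sin (a (i + 1)) - 0)
        - (ℓ v (u i) * Real.sin (a i) - 0) * (ℓ v (u (i + 1)) * Real.cos (a (i + 1)) - 0) = _
      ring
    rw [this]; positivity
  refine ⟨q, fun w => ⟨fun b hb => ?_, fun b c hb hc hbc => ?_⟩⟩
  · obtain ⟨i, hi, ⟨rfl, rfl⟩ | ⟨rfl, rfl⟩⟩ := h.cover w b hb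
    · exact ⟨hdv i hi.le, hdv _ hi, hdd i hi⟩
    · exact ⟨hdv _ hi, hdv i hi.le, by rw [dist_comm, hℓ.symm, hdd i hi]⟩
  -- If `w` comes first in both triangles, or second in both, they coincide. Otherwise one triangle
  -- ends and the other begins at `w`, and since all turn counterclockwise they lie on opposite
  -- sides.
  · obtain ⟨i, hi, ⟨rfl, rfl⟩ | ⟨rfl, rfl⟩⟩ := h.cover w b hb <;>
    obtain ⟨j, hj, ⟨e, rfl⟩ | ⟨e, rfl⟩⟩ := h.cover _ c hc
    · exact absurd (by rw [h.inj_left i hi j hj e]) hbc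
    · have h1 := hcr i hi
      have h2 := hcr j hj
      rw [← e, crossAt_swap_right] at h2
      nlinarith
    · have h1 := hcr i hi
      have h2 := hcr j hj
      rw [← e] at h2
      rw [crossAt_swap_right] at h1
      nlinarith
    · exact absurd (by rw [h.inj_right i hi j hj e]) hbc

end IsLinkEnumeration

end Complex

section Complex

variable {V : Type*} [Fintype V] [DecidableEq V] {S : AbstractSimplicialComplex V}

/-! ### Simplices in the plane -/

/-- Recording which coordinates may be nonzero treats all faces of a triangle at once: intersections
of simplices reduce to comparing coordinates based at `v`. -/
theorem exists_coords_of_mem_convexHull {p : V → Plane} {s : Finset V} {v a b : V}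
    (hs : s ⊆ {v, a, b}) {x : Plane} (hx : x ∈ convexHull ℝ (p '' (s : Set V))) :
    ∃ c d : ℝ, 0 ≤ c ∧ 0 ≤ d ∧ c + d ≤ 1 ∧ (c ≠ 0 → a ∈ s) ∧ (d ≠ 0 → b ∈ s) ∧
      x = p v + c • (p a - p v) + d • (p b - p v) := by
  let T : Set Plane := {x | ∃ c d : ℝ, 0 ≤ c ∧ 0 ≤ d ∧ c + d ≤ 1 ∧ (c ≠ 0 → a ∈ s) ∧
    (d ≠ 0 → b ∈ s) ∧ x = p v + c • (p a - p v) + d • (p b - p v)}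
  have hT : Convex ℝ T := by
    rintro x ⟨c, d, hc, hd, hcd, hca, hdb, rfl⟩ y ⟨c', d', hc', hd', hcd', hca', hdb', rfl⟩
      r t hr ht hrt
    refine ⟨r * c + t * c', r * d + t * d', by positivity, by positivity, ?_, ?_, ?_, ?_⟩
    · calc r * c + t * c' + (r * d + t * d') = r * (c + d) + t * (c' + d') := by ring
        _ ≤ r * 1 + t * 1 := by gcongr
        _ = 1 := by linarith
    · intro h
      by_contra ha
      exact h (by rw [not_imp_comm.1 hca ha, not_imp_comm.1 hca' ha]; ring)
    · intro h
      by_contra ha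
      exact h (by rw [not_imp_comm.1 hdb ha, not_imp_comm.1 hdb' ha]; ring)
    · have : r = 1 - t := by linarith
      subst this
      module
  refine convexHull_min ?_ hT hx
  rintro _ ⟨w, hw, rfl⟩
  have hw' := hs hw
  simp only [Finset.mem_insert, Finset.mem_singleton] at hw'
  rcases hw' with rfl | rfl | rfl
  · exact ⟨0, 0, le_rfl, le_rfl, by norm_num, fun h => absurd rfl h, fun h => absurd rfl h,
      by simp⟩
  · exact ⟨1, 0, zero_le_one, le_rfl, by norm_num, fun _ => hw, fun h => absurd rfl h, by simp⟩
  · exact ⟨0, 1, le_rfl, zero_le_one, by norm_num, fun h => absurd rfl h, fun _ => hw, by simp⟩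

theorem mem_convexHull_of_coords {p : V → Plane} {s : Finset V} {v a b : V} (hv : v ∈ s)
    {x : Plane} {c d : ℝ} (hc : 0 ≤ c) (hd : 0 ≤ d) (hcd : c + d ≤ 1) (ha : c ≠ 0 → a ∈ s)
    (hb : d ≠ 0 → b ∈ s) (hx : x = p v + c • (p a - p v) + d • (p b - p v)) :
    x ∈ convexHull ℝ (p '' (s : Set V)) := by
  have key : ∀ (e : ℝ) (w : V), (e ≠ 0 → w ∈ s) →
      ∃ y ∈ convexHull ℝ (p '' (s : Set V)), e • y = e • p w := by
    intro e w hw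
    by_cases he : e = 0
    · exact ⟨p v, subset_convexHull ℝ _ ⟨v, hv, rfl⟩, by rw [he, zero_smul, zero_smul]⟩
    · exact ⟨p w, subset_convexHull ℝ _ ⟨w, hw he, rfl⟩, rfl⟩
  obtain ⟨y, hy, ey⟩ := key c a ha
  obtain ⟨z, hz, ez⟩ := key d b hb
  have hmem := (convex_convexHull ℝ (p '' (s : Set V))).sum_mem (t := Finset.univ)
    (w := ![1 - c - d, c, d]) (z := ![p v, y, z])
    (by intro i _; fin_cases i <;> simp <;> linarith)
    (by simp [Fin.sum_univ_three]; ring)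
    (by intro i _; fin_cases i
        · exact subset_convexHull ℝ _ ⟨v, hv, rfl⟩
        · exact hy
        · exact hz)
  rw [Fin.sum_univ_three] at hmem
  change (1 - c - d) • p v + c • y + d • z ∈ _ at hmem
  rw [ey, ez] at hmem
  rw [hx]
  convert hmem using 1
  module

theorem crossAt_add_smul (x y z : Plane) (c d : ℝ) :
    crossAt x y (x + c • (y - x) + d • (z - x)) = d * crossAt x y z := by
  simp [crossAt]; ring

theorem crossAt_add_smul' (x y z : Plane) (c d : ℝ) :
    crossAt x z (x + c • (y - x) + d • (z - x)) = c * crossAt x z y := by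
  simp [crossAt]; ring

theorem coords_unique {x y z : Plane} (h : crossAt x y z ≠ 0) {c d c' d' : ℝ}
    (e : x + c • (y - x) + d • (z - x) = x + c' • (y - x) + d' • (z - x)) :
    c = c' ∧ d = d' := by
  constructor
  · have := congrArg (crossAt x z) e
    rw [crossAt_add_smul', crossAt_add_smul'] at this
    refine mul_right_cancel₀ ?_ this
    rwa [crossAt_swap_right, neg_ne_zero]
  · have := congrArg (crossAt x y) e
    rw [crossAt_add_smul, crossAt_add_smul] at this
    exact mul_right_cancel₀ h this

theorem exists_smul_of_crossAt_eq_zero {x y z : Plane} (hxy : x ≠ y) (h : crossAt x y z = 0) :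
    ∃ k : ℝ, z - x = k • (y - x) := by
  have hn : (y 0 - x 0) ^ 2 + (y 1 - x 1) ^ 2 ≠ 0 := by
    rw [← Plane.dist_sq]; exact pow_ne_zero 2 (dist_ne_zero.2 hxy.symm)
  obtain ⟨k, hk⟩ : ∃ k, k * ((y 0 - x 0) ^ 2 + (y 1 - x 1) ^ 2) = dotAt x y z :=
    ⟨_, div_mul_cancel₀ _ hn⟩
  refine ⟨k, ?_⟩
  unfold dotAt at hk
  unfold crossAt at h
  obtain ⟨h1, h2⟩ := eq_of_dot_cross (c := z 0 - x 0) (d := z 1 - x 1) (e := k * (y 0 - x 0))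
    (f := k * (y 1 - x 1)) hn (by linear_combination -hk) (by linear_combination h)
  apply Plane.ext
  · simpa using h1
  · simpa using h2

theorem affineIndependent_iff_crossAt_ne_zero {x y z : Plane} :
    AffineIndependent ℝ ![x, y, z] ↔ crossAt x y z ≠ 0 := by
  rw [affineIndependent_iff_not_collinear_set, not_iff_not,
    collinear_iff_of_mem (Set.mem_insert x {y, z})]
  constructor
  · rintro ⟨w, hw⟩
    obtain ⟨r, rfl⟩ := hw y (by simp)
    obtain ⟨t, rfl⟩ := hw z (by simp)
    simp [crossAt]; ring
  · intro h
    by_cases hxy : x = y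
    · refine ⟨z - x, ?_⟩
      rintro q (rfl | rfl | rfl)
      · exact ⟨0, by simp⟩
      · exact ⟨0, by simp [hxy]⟩
      · exact ⟨1, by simp⟩
    · obtain ⟨k, hk⟩ := exists_smul_of_crossAt_eq_zero hxy h
      refine ⟨y - x, ?_⟩
      rintro q (rfl | rfl | rfl)
      · exact ⟨0, by simp⟩
      · exact ⟨1, by simp⟩
      · exact ⟨k, by rw [← hk]; simp⟩

theorem affineIndependent_of_crossAt_ne_zero {p : V → Plane} {v a b : V} {s : Finset V}
    (hs : s ⊆ {v, a, b}) (h : crossAt (p v) (p a) (p b) ≠ 0) :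
    AffineIndependent ℝ fun x : s => p x := by
  classical
  have hs' : ∀ x : s, x.1 = v ∨ x.1 = a ∨ x.1 = b := fun x => by simpa using hs x.2
  let f : s → Fin 3 := fun x => if x.1 = v then 0 else if x.1 = a then 1 else 2
  have hf : ∀ x, ![v, a, b] (f x) = x.1 := by
    intro x
    simp only [f]
    split_ifs with h1 h2
    · exact h1.symm
    · exact h2.symm
    · exact (((hs' x).resolve_left h1).resolve_left h2).symm
  have hinj : Function.Injective f := fun x y e => Subtype.ext (by rw [← hf x, ← hf y, e])
  convert (affineIndependent_iff_crossAt_ne_zero.2 h).comp_embedding ⟨f, hinj⟩ using 1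
  funext x
  change p x = ![p v, p a, p b] (f x)
  rw [← hf x]
  generalize f x = i
  fin_cases i <;> rfl

theorem crossAt_ne_zero_of_affineIndependent {p : V → Plane} {v a b : V} (hva : v ≠ a)
    (hvb : v ≠ b) (hab : a ≠ b)
    (h : AffineIndependent ℝ fun x : ({v, a, b} : Finset V) => p x) :
    crossAt (p v) (p a) (p b) ≠ 0 := by
  rw [← affineIndependent_iff_crossAt_ne_zero]
  let f : Fin 3 → ({v, a, b} : Finset V) := ![⟨v, by simp⟩, ⟨a, by simp⟩, ⟨b, by simp⟩]
  have hinj : Function.Injective f := by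
    intro i j e
    fin_cases i <;> fin_cases j <;> simp [f, hva, hvb, hab, hva.symm, hvb.symm, hab.symm] at e ⊢
  convert h.comp_embedding ⟨f, hinj⟩ using 1
  funext i
  fin_cases i <;> rfl

theorem dist_lt_of_crossAt_ne_zero {x y z : Plane} (h : crossAt x y z ≠ 0) :
    dist x z < dist x y + dist y z := by
  refine lt_of_le_of_ne (dist_triangle x y z) fun e => h ?_
  have key := crossAt_mul_crossAt x y z z
  rw [dotAt_eq_dist, dotAt_eq_dist, dist_self, e] at key
  have : crossAt x y z * crossAt x y z = 0 := by rw [key]; ring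
  exact mul_self_eq_zero.1 this

/-- Two triangles with a common side that do not overlap lie on different sides of it. -/
theorem crossAt_mul_neg_of_inter {p : V → Plane} {v a b c : V} (hb : b ≠ v ∧ b ≠ a)
    (h1 : crossAt (p v) (p a) (p b) ≠ 0) (h2 : crossAt (p v) (p a) (p c) ≠ 0)
    (hinter : convexHull ℝ (p '' (({v, a, b} : Finset V) : Set V)) ∩
      convexHull ℝ (p '' (({v, a, c} : Finset V) : Set V))
      ⊆ convexHull ℝ (p '' (({v, a} : Finset V) : Set V))) :
    crossAt (p v) (p a) (p b) * crossAt (p v) (p a) (p c) < 0 := by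
  by_contra! hpos
  set β := crossAt (p v) (p a) (p b) with hβ
  set γ := crossAt (p v) (p a) (p c) with hγ
  have hsame : |γ| * β = |β| * γ := by
    rcases lt_or_gt_of_ne h1 with hb | hb <;> rcases lt_or_gt_of_ne h2 with hc | hc
    · rw [abs_of_neg hb, abs_of_neg hc]; ring
    · nlinarith
    · nlinarith
    · rw [abs_of_pos hb, abs_of_pos hc]; ring
  have hne := ne_of_crossAt_ne_zero h1
  -- If `b` and `c` were on the same side, this combination would cancel their heights over the
  -- line, leaving a multiple `k` of `p a - p v`.
  obtain ⟨k, hk⟩ := exists_smul_of_crossAt_eq_zero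
    (z := p v + |γ| • (p b - p v) + (-|β|) • (p c - p v)) hne (by
      have : crossAt (p v) (p a) (p v + |γ| • (p b - p v) + (-|β|) • (p c - p v))
          = |γ| * β - |β| * γ := by simp [crossAt, hβ, hγ]; ring
      rw [this, hsame, sub_self])
  -- So small that the midpoint of the common side, pushed by `ε * |γ|` towards `b`, stays in both
  -- triangles, with coordinates `1/2 + ε * k` and `ε * |β|` in the second.
  obtain ⟨ε, hε, hsmall⟩ : ∃ ε : ℝ, 0 < ε ∧ ε * (|β| + |γ| + |k|) ≤ 1 / 2 := by
    refine ⟨1 / (2 * (1 + |β| + |γ| + |k|)), by positivity, ?_⟩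
    rw [div_mul_eq_mul_div, one_mul, div_le_div_iff₀ (by positivity) (by norm_num)]
    linarith
  have hkabs := abs_le.1 (le_refl |k|)
  have hγp := abs_pos.2 h2
  have b1 : 0 ≤ ε * |β| := by positivity
  have b2 : 0 ≤ ε * |γ| := by positivity
  have b3 : 0 ≤ ε * |k| := by positivity
  have b4 : ε * k ≤ ε * |k| := by gcongr; exact hkabs.2
  have b5 : -(ε * |k|) ≤ ε * k := by rw [← mul_neg]; gcongr; exact hkabs.1
  have hmem : p v + (1 / 2 : ℝ) • (p a - p v) + (ε * |γ|) • (p b - p v)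
      ∈ convexHull ℝ (p '' (({v, a} : Finset V) : Set V)) := by
    refine hinter ⟨mem_convexHull_of_coords (v := v) (a := a) (b := b) (c := 1 / 2)
      (d := ε * |γ|) (by simp) (by norm_num) b2 (by nlinarith) (by simp) (by simp) rfl,
      mem_convexHull_of_coords (v := v) (a := a) (b := c) (c := 1 / 2 + ε * k) (d := ε * |β|)
        (by simp) (by nlinarith) b1 (by nlinarith) (by simp) (by simp) ?_⟩
    have : ε • (p v + |γ| • (p b - p v) + (-|β|) • (p c - p v) - p v)
        = ε • k • (p a - p v) := by rw [hk]
    rw [add_smul, mul_smul ε k, ← this]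
    module
  obtain ⟨c', d', -, -, -, -, hd', e⟩ := exists_coords_of_mem_convexHull (v := v) (a := a) (b := b)
    (by intro x; simp only [Finset.mem_insert, Finset.mem_singleton]; tauto) hmem
  have := (coords_unique h1 e).2
  have hd0 : d' ≠ 0 := by rw [← this]; positivity
  have := hd' hd0
  simp only [Finset.mem_insert, Finset.mem_singleton] at this
  tauto

theorem IsCombinatorialClosedDisk.exists_triangle_supset (hS : IsCombinatorialClosedDisk S)
    {s : Finset V} (hs : s ∈ S.faces) {v : V} (hv : v ∈ s) :
    ∃ a b, ({v, a, b} : Finset V) ∈ triangles S ∧ s ⊆ {v, a, b} := by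
  have h3 := hS.card_le s hs
  have e := Finset.insert_erase hv
  have hc := Finset.card_erase_of_mem hv
  have h1 : 1 ≤ s.card := Finset.card_pos.2 ⟨v, hv⟩
  obtain h | h | h : (s.erase v).card = 0 ∨ (s.erase v).card = 1 ∨ (s.erase v).card = 2 := by
    omega
  · rw [Finset.card_eq_zero] at h
    obtain ⟨a, ha⟩ := hS.exists_adj v
    obtain ⟨b, hb⟩ := hS.exists_triangle ha
    refine ⟨a, b, hb, ?_⟩
    rw [← e, h]; simp
  · obtain ⟨a, ha⟩ := Finset.card_eq_one.1 h
    have hva : v ≠ a := by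
      rintro rfl
      have : v ∈ s.erase v := by rw [ha]; simp
      simp at this
    obtain ⟨b, hb⟩ := hS.exists_triangle (v := v) (a := a) ⟨hva, by rw [← ha, e]; exact hs⟩
    refine ⟨a, b, hb, ?_⟩
    rw [← e, ha]
    intro x; simp only [Finset.mem_insert, Finset.mem_singleton]; tauto
  · obtain ⟨a, b, hab, ha⟩ := Finset.card_eq_two.1 h
    refine ⟨a, b, ?_, ?_⟩
    · rw [← ha, e]; exact mem_triangles.2 ⟨hs, by omega⟩
    · rw [← ha, e]

end Complex

section Complex

variable {V : Type*} [Fintype V] [DecidableEq V] {S : AbstractSimplicialComplex V}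

/-! ### Stars of interior vertices -/

/-- The edges of a developed star at an interior vertex in polar coordinates; `ε` is the
orientation. -/
theorem IsLinkEnumeration.exists_polar {v : V} {n : ℕ} {u : ℕ → V}
    (h : IsLinkEnumeration S v n u) (hu : u n = u 0) (hn : 3 ≤ n) {ℓ : V → V → ℝ}
    (hℓ : IsLengthFunction S ℓ) {p : V → Plane} (hp : IsStarDevelopment S ℓ v p) :
    ∃ (ε : ℝ) (a : ℕ → ℝ), ε ^ 2 = 1 ∧
      (∀ k, a k = a 0 + ∑ i ∈ Finset.range k, cornerAngle ℓ v (u i) (u (i + 1))) ∧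
      (∀ i < n, a i < a (i + 1) ∧ a (i + 1) < a i + Real.pi) ∧
      ∀ i ≤ n, p (u i) 0 - p v 0 = ℓ v (u i) * Real.cos (a i) ∧
        ε * (p (u i) 1 - p v 1) = ℓ v (u i) * Real.sin (a i) := by
  -- The sign is fixed by the first triangle and propagates, since consecutive triangles lie on
  -- opposite sides of their common edge.
  obtain ⟨ε, hε, hε0⟩ : ∃ ε : ℝ, ε ^ 2 = 1 ∧ 0 < ε * crossAt (p v) (p (u 0)) (p (u 1)) := by
    rcases lt_or_gt_of_ne ((hp (u 0)).crossAt_ne_zero hℓ (h.triangle 0 h.pos)) with hc | hc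
    · exact ⟨-1, by norm_num, by simpa using hc⟩
    · exact ⟨1, by norm_num, by simpa using hc⟩
  have hcr : ∀ i < n, 0 < ε * crossAt (p v) (p (u i)) (p (u (i + 1))) := by
    intro i
    induction i with
    | zero => exact fun _ => hε0
    | succ i ih =>
      intro hi
      have h1 := ih (by omega)
      have h2 := (hp (u (i + 1))).opposite (u i) (u (i + 2))
        (triangles_swap_right (h.triangle i (by omega))) (h.triangle (i + 1) hi)
        fun e => h.not_swap hu hn (show i < n by omega) hi e rfl
      rw [crossAt_swap_right] at h2
      by_contra! h3
      nlinarith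
  have hdist : ∀ i ≤ n, dist (p v) (p (u i)) = ℓ v (u i) := by
    intro i hi
    rcases hi.lt_or_eq with hi | rfl
    · exact ((hp _).dist _ (h.triangle i hi)).1
    · rw [hu]; exact ((hp _).dist _ (h.triangle 0 h.pos)).1
  have hsq : ∀ i ≤ n, (p (u i) 0 - p v 0) ^ 2 + (ε * (p (u i) 1 - p v 1)) ^ 2
      = ℓ v (u i) ^ 2 := by
    intro i hi
    rw [← hdist i hi, Plane.dist_sq]
    linear_combination (p (u i) 1 - p v 1) ^ 2 * hε
  set Z : ℂ := ⟨p (u 0) 0 - p v 0, ε * (p (u 0) 1 - p v 1)⟩ with hZ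
  have hn0 : ‖Z‖ = ℓ v (u 0) := by
    rw [← sq_eq_sq₀ (norm_nonneg _) (h.length_pos hℓ (Nat.zero_le n)).le,
      ← hsq 0 (Nat.zero_le n), ← Complex.normSq_eq_norm_sq, Complex.normSq_apply]
    ring
  set a : ℕ → ℝ := fun k => Z.arg + ∑ i ∈ Finset.range k, cornerAngle ℓ v (u i) (u (i + 1))
    with ha
  have ha0 : a 0 = Z.arg := by simp [ha]
  have hsucc : ∀ k, a (k + 1) = a k + cornerAngle ℓ v (u k) (u (k + 1)) := fun k => by
    simp only [ha, Finset.sum_range_succ, add_assoc]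
  refine ⟨ε, a, hε, fun k => by rw [ha0], fun i hi => ?_, fun i => ?_⟩
  · obtain ⟨h1, h2, -⟩ := hℓ.cornerAngle_spec (h.triangle i hi)
    rw [hsucc]
    constructor <;> linarith
  · induction i with
    | zero =>
      intro _
      rw [ha0, ← hn0, Complex.norm_mul_cos_arg, Complex.norm_mul_sin_arg]
      exact ⟨rfl, rfl⟩
    | succ i ih =>
      intro hi
      obtain ⟨e0, e1⟩ := ih (by omega)
      obtain ⟨h1, h2, h3⟩ := hℓ.cornerAngle_spec (h.triangle i hi)
      rw [hsucc]
      refine polar_turn (h.length_pos hℓ (by omega)) (h.length_pos hℓ hi) h1 h2 e0 e1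
        (hsq (i + 1) hi) ?_ ?_
      · obtain ⟨d1, d2, d3⟩ := (hp _).dist _ (h.triangle i hi)
        have e := dotAt_eq_dist (p v) (p (u i)) (p (u (i + 1)))
        rw [d1, d2, d3] at e
        unfold dotAt at e
        linear_combination e + (p (u i) 1 - p v 1) * (p (u (i + 1)) 1 - p v 1) * hε - h3 / 2
      · have := hcr i hi
        unfold crossAt at this
        linarith

theorem linear_coords {x y z : Plane} {c d : ℝ} {w : Plane}
    (h : w = x + c • (y - x) + d • (z - x)) (i : Fin 2) :
    w i - x i = c * (y i - x i) + d * (z i - x i) := by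
  rw [h]; simp; ring

/-- In a triangulation without overlap, the angle sum at an interior vertex is `2π`. -/
theorem IsLinkEnumeration.sum_cornerAngle_eq_two_pi {v : V} {n : ℕ} {u : ℕ → V}
    (h : IsLinkEnumeration S v n u) (hu : u n = u 0) (hn : 3 ≤ n) {ℓ : V → V → ℝ}
    (hℓ : IsLengthFunction S ℓ) {p : V → Plane} (hp : IsStarDevelopment S ℓ v p)
    (hinter : ∀ s ∈ S.faces, ∀ t ∈ S.faces, v ∈ s → v ∈ t →
      convexHull ℝ (p '' (s : Set V)) ∩ convexHull ℝ (p '' (t : Set V))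
        ⊆ convexHull ℝ (p '' ((s ∩ t : Finset V) : Set V))) :
    ∑ i ∈ Finset.range n, cornerAngle ℓ v (u i) (u (i + 1)) = 2 * Real.pi := by
  obtain ⟨ε, a, hε, hsum, hmono, hpol⟩ := h.exists_polar hu hn hℓ hp
  have hr : ∀ i ≤ n, 0 < ℓ v (u i) := fun i hi => h.length_pos hℓ hi
  obtain ⟨e0, e1⟩ := hpol 0 (Nat.zero_le n)
  obtain ⟨f0, f1⟩ := hpol n le_rfl
  rw [hu] at f0 f1
  have h0 := hr 0 (Nat.zero_le n)
  have hwind : a n = a 0 + 2 * Real.pi := by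
    refine winding_eq_one h.pos hmono (mul_left_cancel₀ h0.ne' (f0.symm.trans e0))
      (mul_left_cancel₀ h0.ne' (f1.symm.trans e1)) ?_
    intro j hj hj' c d hc hd hcos hsin
    obtain ⟨g0, g1⟩ := hpol j (by omega)
    obtain ⟨k0, k1⟩ := hpol (j + 1) hj'.le
    have hrj := hr j (by omega)
    have hrk := hr (j + 1) hj'.le
    set r := ℓ v (u 0)
    set s := ℓ v (u j)
    set w := ℓ v (u (j + 1))
    -- With `t = 1 / D`, the point at distance `t` from `p v` in direction `a 0` has coordinates of
    -- sum at most one both in the edge to `u 0` and in triangle `j`.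
    set D := 1 / r + c / s + d / w with hD
    have hDpos : 0 < D := by positivity
    set t := 1 / D with ht
    have htpos : 0 < t := by positivity
    have htD : t * (1 / r + c / s + d / w) = 1 := by rw [ht, ← hD]; field_simp
    have b1 : 0 < t * (1 / r) := by positivity
    have b2 : 0 ≤ t * (c / s) := by positivity
    have b3 : 0 ≤ t * (d / w) := by positivity
    have htri := h.triangle j (by omega)
    have htri0 := h.triangle 0 h.pos
    have hx : p v + (t * (1 / r)) • (p (u 0) - p v) + (0 : ℝ) • (p (u 1) - p v)
        = p v + (t * (c / s)) • (p (u j) - p v) + (t * (d / w)) • (p (u (j + 1)) - p v) := by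
      apply Plane.ext
      · have : p v 0 + t * (1 / r) * (p (u 0) 0 - p v 0) + 0 * (p (u 1) 0 - p v 0)
          = p v 0 + t * (c / s) * (p (u j) 0 - p v 0)
            + t * (d / w) * (p (u (j + 1)) 0 - p v 0) := by
          rw [e0, g0, k0, hcos]
          field_simp
          ring
        simpa using this
      · have e1' : p (u 0) 1 - p v 1 = ε * (r * Real.sin (a 0)) := by
          linear_combination ε * e1 - (p (u 0) 1 - p v 1) * hε
        have g1' : p (u j) 1 - p v 1 = ε * (s * Real.sin (a j)) := by
          linear_combination ε * g1 - (p (u j) 1 - p v 1) * hε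
        have k1' : p (u (j + 1)) 1 - p v 1 = ε * (w * Real.sin (a (j + 1))) := by
          linear_combination ε * k1 - (p (u (j + 1)) 1 - p v 1) * hε
        have : p v 1 + t * (1 / r) * (p (u 0) 1 - p v 1) + 0 * (p (u 1) 1 - p v 1)
          = p v 1 + t * (c / s) * (p (u j) 1 - p v 1)
            + t * (d / w) * (p (u (j + 1)) 1 - p v 1) := by
          rw [e1', g1', k1', hsin]
          field_simp
          ring
        simpa using this
    have hcross0 := (hp _).crossAt_ne_zero hℓ htri0
    -- The point differs from `p v`, so the absence of overlap forces `u 0` to be a vertex of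
    -- triangle `j`, contrary to injectivity of the enumeration.
    have hmem := hinter {v, u 0} (adj_of_mem_triangles htri0).2 {v, u j, u (j + 1)}
      (mem_triangles.1 htri).1 (by simp) (by simp)
      ⟨mem_convexHull_of_coords (v := v) (a := u 0) (b := u 1) (c := t * (1 / r)) (d := 0)
          (by simp) b1.le le_rfl (by linarith) (by simp) (by simp) rfl,
        mem_convexHull_of_coords (v := v) (a := u j) (b := u (j + 1)) (c := t * (c / s))
          (d := t * (d / w)) (by simp) b2 b3 (by linarith) (by simp) (by simp) hx⟩
    obtain ⟨c', d', -, -, -, hc', -, e⟩ := exists_coords_of_mem_convexHull (v := v) (a := u 0)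
      (b := u 1) (by
        refine Finset.inter_subset_left.trans ?_
        intro x; simp only [Finset.mem_insert, Finset.mem_singleton]; tauto) hmem
    have hcc := (coords_unique hcross0 e).1
    have hmem0 := hc' (by rw [← hcc]; exact b1.ne')
    simp only [Finset.mem_inter, Finset.mem_insert, Finset.mem_singleton] at hmem0
    rcases hmem0.2 with h1 | h1 | h1
    · exact h.ne_center (Nat.zero_le n) h1
    · have := h.inj_left 0 h.pos j (by omega) h1; omega
    · have := h.inj_left 0 h.pos (j + 1) hj' h1; omega
  have := hsum n
  linarith

/-- In a triangulation without overlap, every star is developed. -/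
theorem isStarDevelopment_of_inter {ℓ : V → V → ℝ} {p : V → Plane}
    (hdist : ∀ v w, (skeleton S).Adj v w → dist (p v) (p w) = ℓ v w)
    (hne : ∀ v a b, ({v, a, b} : Finset V) ∈ triangles S → crossAt (p v) (p a) (p b) ≠ 0)
    (hinter : ∀ σ, IsInteriorSimplex S σ → ∀ s ∈ S.faces, ∀ t ∈ S.faces, σ ⊆ s → σ ⊆ t →
      convexHull ℝ (p '' (s : Set V)) ∩ convexHull ℝ (p '' (t : Set V))
        ⊆ convexHull ℝ (p '' ((s ∩ t : Finset V) : Set V))) (v : V) :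
    IsStarDevelopment S ℓ v p := by
  refine fun w => ⟨fun b hb => ⟨hdist _ _ (adj_of_mem_triangles hb),
    hdist _ _ (adj_of_mem_triangles (triangles_swap_right hb)),
    hdist _ _ (adj_of_mem_triangles (triangles_swap_right (triangles_swap_left hb)))⟩,
    fun b c hb hc hbc => ?_⟩
  obtain ⟨-, n1, n2⟩ := ne_of_mem_triangles hb
  obtain ⟨-, m1, m2⟩ := ne_of_mem_triangles hc
  refine crossAt_mul_neg_of_inter ⟨n1.symm, n2.symm⟩ (hne _ _ _ hb) (hne _ _ _ hc) ?_
  have e : ({v, w, b} : Finset V) ∩ {v, w, c} = {v, w} := by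
    ext x
    simp only [Finset.mem_inter, Finset.mem_insert, Finset.mem_singleton]
    constructor
    · rintro ⟨rfl | rfl | rfl, h | h | h⟩ <;> simp_all
    · tauto
  rw [← e]
  exact hinter {v, w} (isInteriorSimplex_edge hb hc hbc) _ (mem_triangles.1 hb).1 _
    (mem_triangles.1 hc).1
    (by intro x; simp only [Finset.mem_insert, Finset.mem_singleton]; tauto)
    (by intro x; simp only [Finset.mem_insert, Finset.mem_singleton]; tauto)

/-- Developed triangles with a common edge do not overlap. -/
theorem IsEdgeDevelopment.inter_subset {ℓ : V → V → ℝ} {p : V → Plane} {v w b c : V}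
    (h : IsEdgeDevelopment S ℓ v w p) (hb : ({v, w, b} : Finset V) ∈ triangles S)
    (hc : ({v, w, c} : Finset V) ∈ triangles S) :
    convexHull ℝ (p '' (({v, w, b} : Finset V) : Set V)) ∩
      convexHull ℝ (p '' (({v, w, c} : Finset V) : Set V))
      ⊆ convexHull ℝ (p '' ((({v, w, b} : Finset V) ∩ {v, w, c} : Finset V) : Set V)) := by
  by_cases hbc : b = c
  · rw [hbc, Finset.inter_self]; exact Set.inter_subset_left
  rintro x ⟨hx, hx'⟩
  obtain ⟨r, s, hr, hs, hrs, -, -, e⟩ := exists_coords_of_mem_convexHull subset_rfl hx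
  obtain ⟨r', s', hr', hs', hrs', -, -, e'⟩ := exists_coords_of_mem_convexHull subset_rfl hx'
  have h1 : s * crossAt (p v) (p w) (p b) = s' * crossAt (p v) (p w) (p c) := by
    rw [← crossAt_add_smul, ← e, e', crossAt_add_smul]
  have h2 := h.opposite b c hb hc hbc
  have hs0 : s = 0 := by
    by_contra hne
    have hspos := lt_of_le_of_ne hs (Ne.symm hne)
    have hb2 : 0 < crossAt (p v) (p w) (p b) ^ 2 := pow_two_pos_of_ne_zero
      (left_ne_zero_of_mul h2.ne)
    have : s * crossAt (p v) (p w) (p b) ^ 2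
        = s' * (crossAt (p v) (p w) (p b) * crossAt (p v) (p w) (p c)) := by
      linear_combination crossAt (p v) (p w) (p b) * h1
    nlinarith [mul_pos hspos hb2]
  exact mem_convexHull_of_coords (by simp) hr hs hrs (by simp) (fun h => absurd hs0 h) e

/-- Developed triangles at an interior vertex with angle sum `2π` do not overlap. -/
theorem IsLinkEnumeration.inter_subset (hS : IsCombinatorialClosedDisk S) {v : V} {n : ℕ}
    {u : ℕ → V} (h : IsLinkEnumeration S v n u) (hu : u n = u 0) (hn : 3 ≤ n) {ℓ : V → V → ℝ}
    (hℓ : IsLengthFunction S ℓ) {p : V → Plane} (hp : IsStarDevelopment S ℓ v p)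
    (hflat : ∑ i ∈ Finset.range n, cornerAngle ℓ v (u i) (u (i + 1)) = 2 * Real.pi)
    {s t : Finset V} (hs : s ∈ S.faces) (ht : t ∈ S.faces) (hvs : v ∈ s) (hvt : v ∈ t) :
    convexHull ℝ (p '' (s : Set V)) ∩ convexHull ℝ (p '' (t : Set V))
      ⊆ convexHull ℝ (p '' ((s ∩ t : Finset V) : Set V)) := by
  obtain ⟨ε, a, hε, hsum, hmono, hpol⟩ := h.exists_polar hu hn hℓ hp
  have han : a n = a 0 + 2 * Real.pi := by rw [hsum n, hflat]
  have hle : ∀ i j, i ≤ j → j ≤ n → a i ≤ a j := by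
    intro i j hij
    induction j, hij using Nat.le_induction with
    | base => exact fun _ => le_rfl
    | succ j _ ih => exact fun hj => (ih (by omega)).trans (hmono j hj).1.le
  have hlt : ∀ i j, i < j → j ≤ n → a i < a j := fun i j hij hj =>
    (hmono i (by omega)).1.trans_le (hle (i + 1) j hij hj)
  have hface : ∀ {s : Finset V}, s ∈ S.faces → v ∈ s → ∃ i < n, s ⊆ {v, u i, u (i + 1)} := by
    intro s hs hvs
    obtain ⟨b, c, htri, hsub⟩ := hS.exists_triangle_supset hs hvs
    obtain ⟨i, hi, ⟨rfl, rfl⟩ | ⟨rfl, rfl⟩⟩ := h.cover b c htri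
    · exact ⟨i, hi, hsub⟩
    · exact ⟨i, hi, by rwa [Finset.pair_comm (u i)]⟩
  have hcross : ∀ i < n, crossAt (p v) (p (u i)) (p (u (i + 1))) ≠ 0 := fun i hi =>
    (hp _).crossAt_ne_zero hℓ (h.triangle i hi)
  have main : ∀ {s t : Finset V} {i j : ℕ}, v ∈ s → v ∈ t → i < j → j < n →
      s ⊆ {v, u i, u (i + 1)} → t ⊆ {v, u j, u (j + 1)} →
      convexHull ℝ (p '' (s : Set V)) ∩ convexHull ℝ (p '' (t : Set V))
        ⊆ convexHull ℝ (p '' ((s ∩ t : Finset V) : Set V)) := by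
    rintro s t i j hvs hvt hij hj hsi htj x ⟨hx, hx'⟩
    obtain ⟨c, d, hc, hd, hcd, hcs, hds, e⟩ := exists_coords_of_mem_convexHull hsi hx
    obtain ⟨c', d', hc', hd', hcd', hct, hdt, e'⟩ := exists_coords_of_mem_convexHull htj hx'
    obtain ⟨A0, A1⟩ := hpol i (by omega)
    obtain ⟨B0, B1⟩ := hpol (i + 1) (by omega)
    obtain ⟨C0, C1⟩ := hpol j (by omega)
    obtain ⟨D0, D1⟩ := hpol (j + 1) hj
    have hv : v ∈ s ∩ t := Finset.mem_inter.2 ⟨hvs, hvt⟩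
    -- The common point is the centre, or lies on the ray between consecutive triangles, or on the
    -- ray where the last triangle meets the first.
    rcases sector_inter (h.length_pos hℓ (by omega : i ≤ n))
      (h.length_pos hℓ (by omega : i + 1 ≤ n)) (h.length_pos hℓ hj.le)
      (h.length_pos hℓ (by omega : j + 1 ≤ n)) hc hd hc' hd' (hmono i (by omega)).1
      (hmono i (by omega)).2 (hle (i + 1) j hij hj.le) (hmono j hj).1 (hmono j hj).2
      ((hle (j + 1) n hj le_rfl).trans (by linarith [hle 0 i (by omega) (by omega)]))
      (by rw [← A0, ← B0, ← C0, ← D0, ← linear_coords e, ← linear_coords e'])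
      (by
        rw [← A1, ← B1, ← C1, ← D1]
        linear_combination -ε * linear_coords e 1 + ε * linear_coords e' 1)
      with ⟨h1, h2⟩ | ⟨h1, h2⟩ | ⟨h1, h2⟩
    · exact mem_convexHull_of_coords hv hc hd hcd (fun h => absurd h1 h) (fun h => absurd h2 h) e
    · have hij' : i + 1 = j := by
        by_contra hne
        exact (hlt (i + 1) j (by omega) hj.le).ne h1
      subst hij'
      have e2 : x = p v + d • (p (u (i + 1)) - p v) + (0 : ℝ) • (p (u (i + 1 + 1)) - p v) := by
        rw [e, h2]; module
      have hdc := (coords_unique (hcross _ hj) (e2.symm.trans e')).1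
      refine mem_convexHull_of_coords hv hc hd hcd (fun h => absurd h2 h) (fun h => ?_) e
      exact Finset.mem_inter.2 ⟨hds h, hct (hdc ▸ h)⟩
    · have hi0 : i = 0 := by
        by_contra hne
        have := hlt 0 i (by omega) (by omega)
        have := hle (j + 1) n hj le_rfl
        linarith
      have hjn : j + 1 = n := by
        by_contra hne
        have := hlt (j + 1) n (by omega) le_rfl
        have := hle 0 i (by omega) (by omega)
        linarith
      have hui : u (j + 1) = u i := by rw [hjn, hu, hi0]
      have e2 : x = p v + (0 : ℝ) • (p (u j) - p v) + c • (p (u (j + 1)) - p v) := by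
        rw [e, h2, hui]; module
      have hdc := (coords_unique (hcross _ hj) (e2.symm.trans e')).2
      refine mem_convexHull_of_coords hv hc hd hcd (fun h => ?_) (fun h => absurd h2 h) e
      exact Finset.mem_inter.2 ⟨hcs h, hui ▸ hdt (hdc ▸ h)⟩
  obtain ⟨i, hi, hsi⟩ := hface hs hvs
  obtain ⟨j, hj, htj⟩ := hface ht hvt
  rcases lt_trichotomy i j with hij | rfl | hij
  · exact main hvs hvt hij hj hsi htj
  · rintro x ⟨hx, hx'⟩
    obtain ⟨c, d, hc, hd, hcd, hcs, hds, e⟩ := exists_coords_of_mem_convexHull hsi hx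
    obtain ⟨c', d', -, -, -, hct, hdt, e'⟩ := exists_coords_of_mem_convexHull htj hx'
    obtain ⟨h1, h2⟩ := coords_unique (hcross i hi) (e.symm.trans e')
    exact mem_convexHull_of_coords (Finset.mem_inter.2 ⟨hvs, hvt⟩) hc hd hcd
      (fun h => Finset.mem_inter.2 ⟨hcs h, hct (h1 ▸ h)⟩)
      (fun h => Finset.mem_inter.2 ⟨hds h, hdt (h2 ▸ h)⟩) e
  · rw [Set.inter_comm, Finset.inter_comm]
    exact main hvt hvs hij hi htj hsi

/-- A development with angle sum `2π` at interior vertices is a triangulation without overlap. -/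
theorem IsCombinatorialClosedDisk.inter_subset_of_development
    (hS : IsCombinatorialClosedDisk S) {ℓ : V → V → ℝ} (hℓ : IsLengthFunction S ℓ)
    {p : V → Plane} (hp : ∀ v, IsStarDevelopment S ℓ v p)
    (hflat : ∀ v n u, IsInteriorVertex S v → IsLinkEnumeration S v n u → u n = u 0 → 3 ≤ n →
      ∑ i ∈ Finset.range n, cornerAngle ℓ v (u i) (u (i + 1)) = 2 * Real.pi)
    {σ s t : Finset V} (hσ : IsInteriorSimplex S σ) (hs : s ∈ S.faces) (ht : t ∈ S.faces)
    (hσs : σ ⊆ s) (hσt : σ ⊆ t) :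
    convexHull ℝ (p '' (s : Set V)) ∩ convexHull ℝ (p '' (t : Set V))
      ⊆ convexHull ℝ (p '' ((s ∩ t : Finset V) : Set V)) := by
  by_cases hst : s ⊆ t
  · rw [Finset.inter_eq_left.2 hst]; exact Set.inter_subset_left
  by_cases hts : t ⊆ s
  · rw [Finset.inter_eq_right.2 hts]; exact Set.inter_subset_right
  have hc := hS.card_le s hs
  have hct := hS.card_le t ht
  have hne : σ ≠ s := fun e => hst (e ▸ hσt)
  have hne' : σ ≠ t := fun e => hts (e ▸ hσs)
  have hlt := Finset.card_lt_card (hσs.ssubset_of_ne hne)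
  have hlt' := Finset.card_lt_card (hσt.ssubset_of_ne hne')
  have hpos : 0 < σ.card := Finset.card_pos.2 (S.isRelLowerSet_faces hσ.1).1
  -- Neither of `s`, `t` contains the other, so `σ` is a proper face of both and is a vertex or an
  -- edge.
  obtain h1 | h2 : σ.card = 1 ∨ σ.card = 2 := by omega
  · obtain ⟨v, rfl⟩ := Finset.card_eq_one.1 h1
    obtain ⟨n, u, h, ⟨h1, -⟩ | ⟨-, hu, hn⟩⟩ := hS.exists_linkEnumeration v
    · exact absurd hσ h1
    · exact h.inter_subset hS hu hn hℓ (hp v) (hflat v n u hσ h hu hn) hs ht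
        (Finset.singleton_subset_iff.1 hσs) (Finset.singleton_subset_iff.1 hσt)
  · obtain ⟨v, w, hvw, rfl⟩ := Finset.card_eq_two.1 h2
    have hthrough : ∀ {r : Finset V}, r ∈ S.faces → {v, w} ⊆ r → 2 < r.card → r.card ≤ 3 →
        ∃ b, ({v, w, b} : Finset V) ∈ triangles S ∧ r = {v, w, b} := by
      intro r hr hsub hlt hle
      refine (mem_trianglesThrough_pair hvw).1 ?_
      exact Finset.mem_filter.2 ⟨mem_triangles.2 ⟨hr, by omega⟩, hsub⟩
    obtain ⟨b, hb, rfl⟩ := hthrough hs hσs (by omega) hc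
    obtain ⟨c, hc', rfl⟩ := hthrough ht hσt (by omega) hct
    exact (hp v w).inter_subset hb hc'

end Complex

/-! ### M-weighted points and Euclidean transformations -/

theorem Fin4.ext {ξ ζ : Fin 4 → ℝ} (h0 : ξ 0 = ζ 0) (h1 : ξ 1 = ζ 1) (h2 : ξ 2 = ζ 2)
    (h3 : ξ 3 = ζ 3) : ξ = ζ := by
  funext i; fin_cases i <;> assumption

theorem planePoint_zero (ξ : Fin 4 → ℝ) : planePoint ξ 0 = ξ 0 / (ξ 3 - ξ 2) := rfl

theorem planePoint_one (ξ : Fin 4 → ℝ) : planePoint ξ 1 = ξ 1 / (ξ 3 - ξ 2) := rfl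

theorem height_pos {ξ : Fin 4 → ℝ} (h : ξ ∈ MWeightedPoints) : 0 < ξ 3 - ξ 2 := sub_pos.2 h

/-- The difference of the points scaled to height one has equal last two coordinates, so its
Minkowski square is the Euclidean square of the difference of positions. -/
theorem dist_planePoint_sq {ξ ζ : Fin 4 → ℝ} (hξ : ξ ∈ MWeightedPoints)
    (hζ : ζ ∈ MWeightedPoints) :
    dist (planePoint ξ) (planePoint ζ) ^ 2 = minkowski ξ ξ / (ξ 3 - ξ 2) ^ 2
      + minkowski ζ ζ / (ζ 3 - ζ 2) ^ 2
      - 2 * minkowski ξ ζ / ((ξ 3 - ξ 2) * (ζ 3 - ζ 2)) := by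
  have h1 := (height_pos hξ).ne'
  have h2 := (height_pos hζ).ne'
  rw [Plane.dist_sq, planePoint_zero, planePoint_zero, planePoint_one, planePoint_one]
  unfold minkowski
  field_simp
  ring

/-- An M-weighted point is determined by its height, its position and its square. -/
theorem MWeightedPoints.ext {ξ ζ : Fin 4 → ℝ} (hξ : ξ ∈ MWeightedPoints)
    (hh : ξ 3 - ξ 2 = ζ 3 - ζ 2) (hp : planePoint ξ = planePoint ζ)
    (hm : minkowski ξ ξ = minkowski ζ ζ) : ξ = ζ := by
  have h := (height_pos hξ).ne'
  have e0 : ξ 0 / (ξ 3 - ξ 2) = ζ 0 / (ζ 3 - ζ 2) := congrArg (fun x : Plane => x 0) hp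
  have e1 : ξ 1 / (ξ 3 - ξ 2) = ζ 1 / (ζ 3 - ζ 2) := congrArg (fun x : Plane => x 1) hp
  rw [← hh, div_left_inj' h] at e0 e1
  have h2 : ξ 2 = ζ 2 := by
    unfold minkowski at hm
    apply mul_left_cancel₀ h
    rw [e0, e1] at hm
    linear_combination -hm / 2 - (ζ 2 + ζ 3 + ξ 3 - ξ 2) / 2 * hh
  exact Fin4.ext e0 e1 h2 (by linarith)

/-- The M-weighted point with logarithmic height `-f`, square `α` and position `x`. -/
noncomputable def liftPoint (α f : ℝ) (x : Plane) : Fin 4 → ℝ :=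
  -- Without the factor `exp (-f)` this is the point of height one, position `x` and square `α * exp
  -- (2 * f)`.
  ![Real.exp (-f) * x 0, Real.exp (-f) * x 1,
    Real.exp (-f) * ((x 0 ^ 2 + x 1 ^ 2 - α * Real.exp (2 * f) - 1) / 2),
    Real.exp (-f) * ((x 0 ^ 2 + x 1 ^ 2 - α * Real.exp (2 * f) + 1) / 2)]

theorem liftPoint_height (α f : ℝ) (x : Plane) :
    liftPoint α f x 3 - liftPoint α f x 2 = Real.exp (-f) := by
  change Real.exp (-f) * ((x 0 ^ 2 + x 1 ^ 2 - α * Real.exp (2 * f) + 1) / 2)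
    - Real.exp (-f) * ((x 0 ^ 2 + x 1 ^ 2 - α * Real.exp (2 * f) - 1) / 2) = _
  ring

theorem liftPoint_mem (α f : ℝ) (x : Plane) : liftPoint α f x ∈ MWeightedPoints := by
  have := Real.exp_pos (-f)
  rw [← liftPoint_height α f x] at this
  exact sub_pos.1 this

theorem planePoint_liftPoint (α f : ℝ) (x : Plane) : planePoint (liftPoint α f x) = x := by
  have h := (Real.exp_pos (-f)).ne'
  apply Plane.ext
  · rw [planePoint_zero, liftPoint_height]
    exact mul_div_cancel_left₀ _ h
  · rw [planePoint_one, liftPoint_height]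
    exact mul_div_cancel_left₀ _ h

theorem minkowski_liftPoint_self (α f : ℝ) (x : Plane) :
    minkowski (liftPoint α f x) (liftPoint α f x) = α := by
  have e : Real.exp (2 * f) * Real.exp (-f) ^ 2 = 1 := by
    rw [← Real.exp_nat_mul, ← Real.exp_add]; norm_num
  change Real.exp (-f) * x 0 * (Real.exp (-f) * x 0) + Real.exp (-f) * x 1 * (Real.exp (-f) * x 1)
    + Real.exp (-f) * ((x 0 ^ 2 + x 1 ^ 2 - α * Real.exp (2 * f) - 1) / 2)
      * (Real.exp (-f) * ((x 0 ^ 2 + x 1 ^ 2 - α * Real.exp (2 * f) - 1) / 2))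
    - Real.exp (-f) * ((x 0 ^ 2 + x 1 ^ 2 - α * Real.exp (2 * f) + 1) / 2)
      * (Real.exp (-f) * ((x 0 ^ 2 + x 1 ^ 2 - α * Real.exp (2 * f) + 1) / 2)) = α
  linear_combination α * e

/-- Euclidean transformations preserve the height `ξ⁴ - ξ³`. -/
theorem height_map_of_mem {L : (Fin 4 → ℝ) ≃ₗ[ℝ] (Fin 4 → ℝ)} (hL : L ∈ euclideanTransformations)
    {ξ : Fin 4 → ℝ} (hξ : ξ ∈ MWeightedPoints) : L ξ 3 - L ξ 2 = ξ 3 - ξ 2 := by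
  obtain ⟨h1, h2, g, h3⟩ := hL
  -- Preserved square and weight determine the positive height, provided that the square is nonzero.
  have key : ∀ ζ ∈ MWeightedPoints, minkowski ζ ζ ≠ 0 → L ζ 3 - L ζ 2 = ζ 3 - ζ 2 := by
    intro ζ hζ hne
    have hw := (h3 ζ hζ).2
    have p1 := height_pos hζ
    have p2 := height_pos ((h2 ζ).2 hζ)
    unfold pointWeight at hw
    rw [h1, div_eq_div_iff (by positivity) (by positivity)] at hw
    exact ((sq_eq_sq₀ p1.le p2.le).1 (mul_left_cancel₀ hne hw)).symm
  by_cases hne : minkowski ξ ξ = 0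
  · set e : Fin 4 → ℝ := ![0, 0, 1, 1] with he
    have hmem : ∀ t : ℝ, ξ + t • e ∈ MWeightedPoints := fun t => by
      change ξ 2 + t * 1 < ξ 3 + t * 1
      exact add_lt_add_left hξ _
    have hmk : ∀ t : ℝ, minkowski (ξ + t • e) (ξ + t • e)
        = minkowski ξ ξ - 2 * t * (ξ 3 - ξ 2) := fun t => by
      change (ξ 0 + t * 0) * (ξ 0 + t * 0) + (ξ 1 + t * 0) * (ξ 1 + t * 0)
        + (ξ 2 + t * 1) * (ξ 2 + t * 1) - (ξ 3 + t * 1) * (ξ 3 + t * 1) = _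
      unfold minkowski; ring
    have hp := height_pos hξ
    have hpt : ∀ t : ℝ, 0 < t → (L ξ 3 + t * L e 3) - (L ξ 2 + t * L e 2) = ξ 3 - ξ 2 := by
      intro t ht
      have := key _ (hmem t) (by
        rw [hmk, hne]
        have : 0 < 2 * t * (ξ 3 - ξ 2) := by positivity
        linarith)
      rw [map_add, map_smul] at this
      change (L ξ 3 + t * L e 3) - (L ξ 2 + t * L e 2) = (ξ 3 + t * 1) - (ξ 2 + t * 1) at this
      linarith
    have a1 := hpt 1 one_pos
    have a2 := hpt 2 two_pos
    linarith
  · exact key ξ hξ hne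

/-- The linear map of M-weighted points that acts on positions as `planarIsometry c s ε b`. -/
noncomputable def euclideanLinearMap (c s ε : ℝ) (b : Plane) : (Fin 4 → ℝ) →ₗ[ℝ] (Fin 4 → ℝ) where
  toFun ξ :=
    ![c * ξ 0 - ε * s * ξ 1 + b 0 * (ξ 3 - ξ 2),
      s * ξ 0 + ε * c * ξ 1 + b 1 * (ξ 3 - ξ 2),
      -- The last two coordinates receive the same summand, which keeps the height; its value
      -- compensates the effect of the translation on the Minkowski square.
      ξ 2 + (c * ξ 0 - ε * s * ξ 1) * b 0 + (s * ξ 0 + ε * c * ξ 1) * b 1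
        + (b 0 ^ 2 + b 1 ^ 2) / 2 * (ξ 3 - ξ 2),
      ξ 3 + (c * ξ 0 - ε * s * ξ 1) * b 0 + (s * ξ 0 + ε * c * ξ 1) * b 1
        + (b 0 ^ 2 + b 1 ^ 2) / 2 * (ξ 3 - ξ 2)]
  map_add' ξ ζ := by
    apply Fin4.ext <;> simp <;> ring
  map_smul' t ξ := by
    apply Fin4.ext <;> simp <;> ring

section EuclideanLinearMap

variable {c s ε : ℝ} {b : Plane} (ξ ζ : Fin 4 → ℝ)

theorem euclideanLinearMap_height :
    euclideanLinearMap c s ε b ξ 3 - euclideanLinearMap c s ε b ξ 2 = ξ 3 - ξ 2 := by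
  simp [euclideanLinearMap]

theorem minkowski_euclideanLinearMap (hcs : c ^ 2 + s ^ 2 = 1) (hε : ε ^ 2 = 1) :
    minkowski (euclideanLinearMap c s ε b ξ) (euclideanLinearMap c s ε b ζ) = minkowski ξ ζ := by
  simp only [minkowski, euclideanLinearMap, LinearMap.coe_mk, AddHom.coe_mk, Matrix.cons_val]
  linear_combination (ξ 0 * ζ 0 + ε ^ 2 * ξ 1 * ζ 1) * hcs + ξ 1 * ζ 1 * hε

theorem planePoint_euclideanLinearMap (hcs : c ^ 2 + s ^ 2 = 1) (hε : ε ^ 2 = 1)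
    (hξ : ξ ∈ MWeightedPoints) :
    planePoint (euclideanLinearMap c s ε b ξ) = planarIsometry c s ε b hcs hε (planePoint ξ) := by
  have h := (height_pos hξ).ne'
  rw [planarIsometry_apply]
  apply Plane.ext
  · rw [planePoint_zero, euclideanLinearMap_height]
    change (c * ξ 0 - ε * s * ξ 1 + b 0 * (ξ 3 - ξ 2)) / (ξ 3 - ξ 2)
      = c * (ξ 0 / (ξ 3 - ξ 2)) - ε * s * (ξ 1 / (ξ 3 - ξ 2)) + b 0
    field_simp
  · rw [planePoint_one, euclideanLinearMap_height]
    change (s * ξ 0 + ε * c * ξ 1 + b 1 * (ξ 3 - ξ 2)) / (ξ 3 - ξ 2)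
      = s * (ξ 0 / (ξ 3 - ξ 2)) + ε * c * (ξ 1 / (ξ 3 - ξ 2)) + b 1
    field_simp

end EuclideanLinearMap

/-- Every isometry of the plane comes from a Euclidean transformation of M-weighted points. -/
theorem exists_euclideanTransformation (g : Plane ≃ᵢ Plane) :
    ∃ L ∈ euclideanTransformations, ∀ ξ ∈ MWeightedPoints,
      planePoint (L ξ) = g (planePoint ξ) := by
  obtain ⟨c, s, ε, b, hcs, hε, rfl⟩ := exists_eq_planarIsometry g
  have hinj : Function.Injective (euclideanLinearMap c s ε b) := by
    rw [injective_iff_map_eq_zero]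
    intro ξ hξ
    have key : ∀ ζ, minkowski ξ ζ = 0 := fun ζ => by
      rw [← minkowski_euclideanLinearMap (b := b) ξ ζ hcs hε, hξ]; simp [minkowski]
    apply Fin4.ext
    · simpa [minkowski] using key ![1, 0, 0, 0]
    · simpa [minkowski] using key ![0, 1, 0, 0]
    · simpa [minkowski] using key ![0, 0, 1, 0]
    · simpa [minkowski] using key ![0, 0, 0, 1]
  refine ⟨LinearEquiv.ofInjectiveEndo _ hinj, ⟨fun ξ ζ => ?_, fun ξ => ?_,
    planarIsometry c s ε b hcs hε, fun ξ hξ => ⟨?_, ?_⟩⟩, fun ξ hξ => ?_⟩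
  · exact minkowski_euclideanLinearMap ξ ζ hcs hε
  · have := euclideanLinearMap_height (c := c) (s := s) (ε := ε) (b := b) ξ
    change euclideanLinearMap c s ε b ξ 2 < euclideanLinearMap c s ε b ξ 3 ↔ ξ 2 < ξ 3
    rw [← sub_pos, this, sub_pos]
  · exact planePoint_euclideanLinearMap ξ hcs hε hξ
  · unfold pointWeight
    change minkowski (euclideanLinearMap c s ε b ξ) (euclideanLinearMap c s ε b ξ)
      / (euclideanLinearMap c s ε b ξ 3 - euclideanLinearMap c s ε b ξ 2) ^ 2 = _
    rw [minkowski_euclideanLinearMap ξ ξ hcs hε, euclideanLinearMap_height]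
  · exact planePoint_euclideanLinearMap ξ hcs hε hξ

/-! ### The correspondence -/

section Correspondence

variable {V : Type*} [Fintype V] [DecidableEq V] {S : AbstractSimplicialComplex V}
  {α : V → ℝ} {η : Sym2 V → ℝ}

theorem IsLabel.isLengthFunction {f : V → ℝ} (hf : IsLabel S α η f) :
    IsLengthFunction S (edgeLength α η f) :=
  ⟨edgeLength_symm α η f, hf.triangle⟩

/-- Flatness of a label as a condition on the angles around interior vertices. -/
theorem curvature_eq_zero_iff {v : V} {n : ℕ} {u : ℕ → V} (h : IsLinkEnumeration S v n u)
    (hu : u n = u 0) (hn : 3 ≤ n) (f : V → ℝ) : curvature S α η f v = 0 ↔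
      ∑ i ∈ Finset.range n, cornerAngle (edgeLength α η f) v (u i) (u (i + 1))
        = 2 * Real.pi := by
  rw [curvature, h.sum_faceAngle hu hn, sub_eq_zero, eq_comm]

namespace MWeightedTriangulation

/-- The position of a vertex. -/
noncomputable def point (T : MWeightedTriangulation S) (v : V) : Plane := planePoint (T.ξ v)

/-- The label of an M-weighted triangulation. -/
noncomputable def label (T : MWeightedTriangulation S) (v : V) : ℝ :=
  -Real.log (T.ξ v 3 - T.ξ v 2)

theorem exp_neg_label (T : MWeightedTriangulation S) (v : V) :
    Real.exp (-T.label v) = T.ξ v 3 - T.ξ v 2 := by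
  rw [label, neg_neg, Real.exp_log (height_pos (T.mem v))]

theorem edgeLengthSq_label {T : MWeightedTriangulation S} (hT : HasProducts T α η) {v w : V}
    (h : (skeleton S).Adj v w) :
    edgeLengthSq α η T.label v w = dist (T.point v) (T.point w) ^ 2 := by
  have hv := (height_pos (T.mem v)).ne'
  have hw := (height_pos (T.mem w)).ne'
  have e : ∀ v, Real.exp (T.label v) = (T.ξ v 3 - T.ξ v 2)⁻¹ := fun v => by
    rw [← T.exp_neg_label, Real.exp_neg, inv_inv]
  have e2 : ∀ v, Real.exp (2 * T.label v) = ((T.ξ v 3 - T.ξ v 2)⁻¹) ^ 2 := fun v => by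
    rw [two_mul, Real.exp_add, e, sq]
  unfold point edgeLengthSq
  rw [dist_planePoint_sq (T.mem v) (T.mem w), hT.1, hT.1, hT.2 v w h, e2, e2, Real.exp_add, e, e]
  field_simp
  ring

theorem edgeLength_label {T : MWeightedTriangulation S} (hT : HasProducts T α η) {v w : V}
    (h : (skeleton S).Adj v w) :
    edgeLength α η T.label v w = dist (T.point v) (T.point w) := by
  rw [edgeLength, edgeLengthSq_label hT h, Real.sqrt_sq dist_nonneg]

theorem crossAt_ne_zero (T : MWeightedTriangulation S) (v a b : V)
    (h : ({v, a, b} : Finset V) ∈ triangles S) :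
    crossAt (T.point v) (T.point a) (T.point b) ≠ 0 := by
  obtain ⟨h1, h2, h3⟩ := ne_of_mem_triangles h
  exact crossAt_ne_zero_of_affineIndependent h1 h2 h3 (T.nondegenerate _ (mem_triangles.1 h).1)

theorem isLabel (hS : IsCombinatorialClosedDisk S) {T : MWeightedTriangulation S}
    (hT : HasProducts T α η) : IsLabel S α η T.label := by
  refine ⟨fun v w h => ?_, fun u v w h => ?_⟩
  · rw [edgeLengthSq_label hT h]
    obtain ⟨b, hb⟩ := hS.exists_triangle h
    have := dist_pos.2 (ne_of_crossAt_ne_zero (T.crossAt_ne_zero v w b hb))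
    positivity
  · rw [edgeLength_label hT (adj_of_mem_triangles h),
      edgeLength_label hT (adj_of_mem_triangles (triangles_swap_right h)),
      edgeLength_label hT (adj_of_mem_triangles (triangles_swap_right (triangles_swap_left h)))]
    exact dist_lt_of_crossAt_ne_zero (T.crossAt_ne_zero u v w h)

theorem isStarDevelopment {T : MWeightedTriangulation S} (hT : HasProducts T α η) (v : V) :
    IsStarDevelopment S (edgeLength α η T.label) v T.point :=
  isStarDevelopment_of_inter (fun _ _ h => (edgeLength_label hT h).symm) T.crossAt_ne_zero
    T.inter_subset v

theorem curvature_label (hS : IsCombinatorialClosedDisk S) {T : MWeightedTriangulation S}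
    (hT : HasProducts T α η) {v : V} (hv : IsInteriorVertex S v) :
    curvature S α η T.label v = 0 := by
  obtain ⟨n, u, h, ⟨h1, -⟩ | ⟨-, hu, hn⟩⟩ := hS.exists_linkEnumeration v
  · exact absurd hv h1
  · rw [curvature_eq_zero_iff h hu hn]
    refine h.sum_cornerAngle_eq_two_pi hu hn (isLabel hS hT).isLengthFunction
      (isStarDevelopment hT v) fun s hs t ht hvs hvt => ?_
    exact T.inter_subset {v} hv s hs t ht (Finset.singleton_subset_iff.2 hvs)
      (Finset.singleton_subset_iff.2 hvt)

/-- The flat label of an M-weighted triangulation with prescribed products. -/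
noncomputable def flatLabel (hS : IsCombinatorialClosedDisk S)
    (T : {T : MWeightedTriangulation S // HasProducts T α η}) : FlatLabel S α η :=
  ⟨T.1.label, isLabel hS T.2, fun _ hv => curvature_label hS T.2 hv⟩

/-- Equal labels give equal edge lengths, so the positions differ by an isometry. Its lift to
M-weighted points matches heights, positions and squares, hence the points themselves. -/
theorem flatLabel_eq_iff (hS : IsCombinatorialClosedDisk S)
    (T T' : {T : MWeightedTriangulation S // HasProducts T α η}) :
    flatLabel hS T = flatLabel hS T' ↔ (euclideanSetoid S α η).r T T' := by
  constructor
  · intro e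
    have e' : T.1.label = T'.1.label := congrArg Subtype.val e
    obtain ⟨g, hg⟩ := hS.development_unique (isLabel hS T.2).isLengthFunction
      (isStarDevelopment T.2) (by rw [e']; exact isStarDevelopment T'.2)
    obtain ⟨L, hL, hLp⟩ := exists_euclideanTransformation g
    refine ⟨L, hL, fun v => MWeightedPoints.ext (T'.1.mem v) ?_ ?_ ?_⟩
    · rw [height_map_of_mem hL (T.1.mem v), ← exp_neg_label, ← exp_neg_label, e']
    · rw [hLp _ (T.1.mem v)]; exact hg v
    · rw [hL.1, T.2.1, T'.2.1]
  · rintro ⟨L, hL, h⟩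
    apply Subtype.ext
    funext v
    change -Real.log _ = -Real.log _
    rw [h v, height_map_of_mem hL (T.1.mem v)]

/-- The edge lengths of a flat label are developed in the plane, and each vertex is lifted to the
M-weighted point with the height and square that the label and `α` dictate. -/
theorem flatLabel_surjective (hS : IsCombinatorialClosedDisk S) :
    Function.Surjective
      (flatLabel hS : {T : MWeightedTriangulation S // HasProducts T α η} → _) := by
  rintro ⟨f, hf, hflat⟩
  have hℓ := hf.isLengthFunction
  have hsum : ∀ v n u, IsInteriorVertex S v → IsLinkEnumeration S v n u → u n = u 0 → 3 ≤ n →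
      ∑ i ∈ Finset.range n, cornerAngle (edgeLength α η f) v (u i) (u (i + 1))
        = 2 * Real.pi :=
    fun v n u hv h hu hn => (curvature_eq_zero_iff h hu hn f).1 (hflat v hv)
  obtain ⟨p, hp⟩ := hS.exists_development hℓ fun v => by
    obtain ⟨n, u, h, ⟨-, hinj⟩ | ⟨hv, hu, hn⟩⟩ := hS.exists_linkEnumeration v
    · exact h.exists_starDevelopment hℓ (Or.inl hinj)
    · exact h.exists_starDevelopment hℓ (Or.inr ⟨hu, hsum v n u hv h hu hn⟩)
  have hpp : (fun v => planePoint (liftPoint (α v) (f v) (p v))) = p :=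
    funext fun v => planePoint_liftPoint _ _ _
  let T : MWeightedTriangulation S :=
    { ξ := fun v => liftPoint (α v) (f v) (p v)
      mem := fun v => liftPoint_mem _ _ _
      nondegenerate := fun s hs => by
        obtain ⟨v, hv⟩ := (S.isRelLowerSet_faces hs).1
        obtain ⟨a, b, htri, hsub⟩ := hS.exists_triangle_supset hs hv
        simp only [planePoint_liftPoint]
        exact affineIndependent_of_crossAt_ne_zero hsub ((hp v a).crossAt_ne_zero hℓ htri)
      inter_subset := fun σ hσ s hs t ht hσs hσt => by
        simp only [simplexImage, hpp]
        exact hS.inter_subset_of_development hℓ hp hsum hσ hs ht hσs hσt }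
  have hprod : HasProducts T α η := by
    refine ⟨fun v => minkowski_liftPoint_self _ _ _, fun v w h => ?_⟩
    obtain ⟨b, hb⟩ := hS.exists_triangle h
    have hd := ((hp v w).dist b hb).1
    have hsq : dist (p v) (p w) ^ 2 = edgeLengthSq α η f v w := by
      rw [hd, edgeLength, Real.sq_sqrt (hf.pos v w h).le]
    have e := dist_planePoint_sq (T.mem v) (T.mem w)
    simp only [T, planePoint_liftPoint, minkowski_liftPoint_self, liftPoint_height] at e ⊢
    rw [hsq, edgeLengthSq, two_mul, two_mul (f w), Real.exp_add, Real.exp_add, Real.exp_add,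
      Real.exp_neg, Real.exp_neg] at e
    have h1 := (Real.exp_pos (f v)).ne'
    have h2 := (Real.exp_pos (f w)).ne'
    field_simp at e
    apply mul_left_cancel₀ (mul_ne_zero h1 h2)
    linarith
  refine ⟨⟨T, hprod⟩, Subtype.ext (funext fun v => ?_)⟩
  change -Real.log (liftPoint (α v) (f v) (p v) 3 - liftPoint (α v) (f v) (p v) 2) = f v
  rw [liftPoint_height, Real.log_exp, neg_neg]

end MWeightedTriangulation

end Correspondence

theorem mainTheorem4 {V : Type*} [Fintype V] [DecidableEq V]
    (S : AbstractSimplicialComplex V) (hS : IsCombinatorialClosedDisk S)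
    (α : V → ℝ) (η : Sym2 V → ℝ) :
    ∃ Φ : Quotient (euclideanSetoid S α η) ≃ FlatLabel S α η,
      ∀ T : {T : MWeightedTriangulation S // HasProducts T α η},
        (∀ v, (Φ (Quotient.mk (euclideanSetoid S α η) T)).1 v
          = -Real.log (T.1.ξ v 3 - T.1.ξ v 2)) ∧
        ∀ v w, (skeleton S).Adj v w →
          edgeLength α η (Φ (Quotient.mk (euclideanSetoid S α η) T)).1 v w
            = dist (planePoint (T.1.ξ v)) (planePoint (T.1.ξ w)) := by
  refine ⟨Equiv.ofBijective (Quotient.lift (MWeightedTriangulation.flatLabel hS)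
    fun T T' h => (MWeightedTriangulation.flatLabel_eq_iff hS T T').2 h) ⟨?_, ?_⟩,
    fun T => ⟨fun v => rfl, fun v w h => MWeightedTriangulation.edgeLength_label T.2 h⟩⟩
  · rintro ⟨T⟩ ⟨T'⟩ h
    exact Quotient.sound ((MWeightedTriangulation.flatLabel_eq_iff hS T T').1 h)
  · intro f
    obtain ⟨T, hT⟩ := MWeightedTriangulation.flatLabel_surjective hS f
    exact ⟨Quotient.mk _ T, hT⟩
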